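/- Let $R$ be a real closed field with its order, let $C=R[i]$ be its algebraic closure, and let $r\ge 2$. A basic semi-algebraic subset of $R^{n}$ is the solution set of finitely many polynomial equations $p=0$ and finitely many strict polynomial inequalities $q>0$; a semi-algebraic set is a finite union of basic semi-algebraic sets; a function between semi-algebraic sets is semi-algebraic if its graph is a semi-algebraic set. Give $R^{n}$ the Euclidean topology, i.e. the one generated by the open balls (equivalently, the product of the order topologies). A semi-algebraic set $S$ is semi-algebraically connected if it is not the disjoint union of two non-empty semi-algebraic subsets that are closed in $S$. Let $f\in R[x_1,\dots,x_r]$ and let $S\subseteq R^{r-1}$ be a semi-algebraically connected semi-algebraic set. Suppose that the leading coefficient $\mathrm{LC}_{x_r}(f)\in R[x_1,\dots,x_{r-1}]$ of $f$ with respect to $x_r$ has no zero on $S$, and that the number of distinct roots in $C$ of the univariate polynomial $f(a,x_r)$ is the same for all $a\in S$. Then the roots of $f$ are delineable over $S$; that is, there are integers $0\le k\le m$, positive integers $\mu_1,\dots,\mu_m$, and functions $\xi_1,\dots,\xi_k:S\to R$ such that: 1. for every $a\in S$, the polynomial $f(a,x)$ has exactly $m$ distinct roots in $C$, with multiplicities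 $\mu_1,\dots,\mu_m$ in some order of the roots; 2. $\xi_1,\dots,\xi_k$ are semi-algebraic and continuous, and $\xi_1(a)<\xi_2(a)<\dots<\xi_k(a)$ for every $a\in S$; 3. for every $a\in S$ and $1\le i\le k$, $\xi_i(a)$ is a root of $f(a,x)$ of multiplicity $\mu_i$; 4. for every $a\in S$ and $b\in R$ with $f(a,b)=0$, there is an $i$ with $b=\xi_i(a)$. -/

import Mathlib

open Polynomial

namespace RealAlg

section Semialgebraic

variable {R : Type*} [Field R] [LinearOrder R] {n : ℕ}

/-- A basic semi-algebraic subset of `Rⁿ`: the solution set of finitely many polynomial equations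
`p = 0` and finitely many strict polynomial inequalities `q > 0`. -/
def IsBasicSemialgebraic (A : Set (Fin n → R)) : Prop :=
  ∃ F G : Finset (MvPolynomial (Fin n) R),
    A = {x | (∀ p ∈ F, MvPolynomial.eval x p = 0) ∧ ∀ q ∈ G, 0 < MvPolynomial.eval x q}

/-- A semi-algebraic subset of `Rⁿ`: a finite union of basic semi-algebraic sets. -/
def IsSemialgebraic (A : Set (Fin n → R)) : Prop :=
  ∃ 𝒰 : Set (Set (Fin n → R)), 𝒰.Finite ∧ (∀ B ∈ 𝒰, IsBasicSemialgebraic B) ∧ A = ⋃₀ 𝒰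

/-- A function `ξ : S → R` on `S ⊆ Rⁿ` is semi-algebraic if its graph
`{(a, ξ a) | a ∈ S} ⊆ Rⁿ⁺¹` is a semi-algebraic set. -/
def IsSemialgebraicFun {S : Set (Fin n → R)} (ξ : S → R) : Prop :=
  IsSemialgebraic {v : Fin (n + 1) → R | ∃ a : S, v = Fin.snoc (α := fun _ => R) a.1 (ξ a)}

/-- A set `S ⊆ Rⁿ` is semi-algebraically connected if it is not the disjoint union of two non-empty
semi-algebraic subsets that are closed in `S`. Here `R` carries its order topology, `Rⁿ` the product
topology (which is the Euclidean one, see `isOpen_iff_euclideanBall`), and `S` the subspace topology. -/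
def IsSemialgebraicallyConnected [TopologicalSpace R] (S : Set (Fin n → R)) : Prop :=
  ¬ ∃ A B : Set (Fin n → R), IsSemialgebraic A ∧ IsSemialgebraic B ∧ A.Nonempty ∧ B.Nonempty ∧
    IsClosed ((↑) ⁻¹' A : Set S) ∧ IsClosed ((↑) ⁻¹' B : Set S) ∧ Disjoint A B ∧ A ∪ B = S

/-- The open Euclidean ball `{y | ‖y - x‖ < r}` for `r > 0`, with the inequality squared. -/
def euclideanBall (x : Fin n → R) (r : R) : Set (Fin n → R) :=
  {y | ∑ i, (y i - x i) ^ 2 < r ^ 2}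

/-- The product topology on `Rⁿ` is the Euclidean topology generated by the open balls. -/
theorem isOpen_iff_euclideanBall [IsStrictOrderedRing R] [TopologicalSpace R] [OrderTopology R]
    (U : Set (Fin n → R)) :
    IsOpen U ↔ ∀ x ∈ U, ∃ r : R, 0 < r ∧ euclideanBall x r ⊆ U := by
  constructor
  · intro hU x hx
    rw [isOpen_pi_iff'] at hU
    obtain ⟨u, hu, hsub⟩ := hU x hx
    have h1 : ∀ i, ∃ ε : R, 0 < ε ∧ ∀ t, |t - x i| < ε → t ∈ u i := by
      intro i
      have := (nhds_basis_abs_sub_lt (x i)).mem_iff.1 ((hu i).1.mem_nhds (hu i).2)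
      obtain ⟨ε, hε, h⟩ := this
      exact ⟨ε, hε, fun t ht => h ht⟩
    choose ε hε h using h1
    obtain ⟨r, hr, hrε⟩ : ∃ r : R, 0 < r ∧ ∀ i, r ≤ ε i := by
      rcases isEmpty_or_nonempty (Fin n) with hn | hn
      · exact ⟨1, one_pos, fun i => (hn.false i).elim⟩
      · obtain ⟨j, hj⟩ := Finite.exists_min ε
        exact ⟨ε j, hε j, hj⟩
    refine ⟨r, hr, fun y hy => hsub fun i _ => h i _ ?_⟩
    have h2 : (y i - x i) ^ 2 < r ^ 2 :=
      lt_of_le_of_lt (Finset.single_le_sum (f := fun i => (y i - x i) ^ 2)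
        (fun i _ => sq_nonneg _) (Finset.mem_univ i)) hy
    exact (abs_lt_of_sq_lt_sq h2 hr.le).trans_le (hrε i)
  · intro h
    rw [isOpen_iff_mem_nhds]
    intro x hx
    obtain ⟨r, hr, hs⟩ := h x hx
    refine Filter.mem_of_superset ?_ hs
    have hc : Continuous fun y : Fin n → R => ∑ i, (y i - x i) ^ 2 := by fun_prop
    exact (isOpen_lt hc continuous_const).mem_nhds (by simpa using pow_pos hr 2)

end Semialgebraic

section Delineability

variable {R : Type*} [Field R] {n : ℕ}

/-- The identification `R[x₁, …, xₙ₊₁] = R[x₁, …, xₙ][xₙ₊₁]` singling out the last variable. -/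
noncomputable def lastVarEquiv (R : Type*) [Field R] (n : ℕ) :
    MvPolynomial (Fin (n + 1)) R ≃ₐ[R] (MvPolynomial (Fin n) R)[X] :=
  (MvPolynomial.renameEquiv R finSuccEquivLast).trans (MvPolynomial.optionEquivLeft R (Fin n))

/-- The leading coefficient of `f` with respect to the last variable. -/
noncomputable def lastLC (f : MvPolynomial (Fin (n + 1)) R) : MvPolynomial (Fin n) R :=
  (lastVarEquiv R n f).leadingCoeff

/-- The univariate polynomial `f(a₁, …, aₙ, x)`. -/
noncomputable def fiber (f : MvPolynomial (Fin (n + 1)) R) (a : Fin n → R) : R[X] :=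
  (lastVarEquiv R n f).map (MvPolynomial.eval a)

theorem eval_fiber (f : MvPolynomial (Fin (n + 1)) R) (a : Fin n → R) (b : R) :
    (fiber f a).eval b = MvPolynomial.eval (Fin.snoc (α := fun _ => R) a b) f := by
  induction f using MvPolynomial.induction_on with
  | C c => simp [fiber, lastVarEquiv]
  | add p q hp hq => simpa [fiber] using congrArg₂ (· + ·) hp hq
  | mul_X p i hp =>
    have hX : (fiber (MvPolynomial.X i) a).eval b = Fin.snoc (α := fun _ => R) a b i := by
      refine Fin.lastCases ?_ (fun j => ?_) i <;> simp [fiber, lastVarEquiv]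
    have hm : fiber (p * MvPolynomial.X i) a = fiber p a * fiber (MvPolynomial.X i) a := by
      simp [fiber]
    rw [hm, eval_mul, hp, hX]; simp

/-- The polynomial `f(a₁, …, aₙ, x)` over the algebraic closure of `R`
(which is `R[i]` when `R` is real closed). -/
noncomputable def complexFiber (f : MvPolynomial (Fin (n + 1)) R) (a : Fin n → R) :
    (AlgebraicClosure R)[X] :=
  (fiber f a).map (algebraMap R (AlgebraicClosure R))

/-- The set of distinct complex roots of `f(a₁, …, aₙ, x)`. -/
def complexRoots (f : MvPolynomial (Fin (n + 1)) R) (a : Fin n → R) : Set (AlgebraicClosure R) :=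
  {z | (complexFiber f a).IsRoot z}

/-- The functions `ξ₁, …, ξ_k : S → R` delineate the real roots of `f` over `S ⊆ Rⁿ`. -/
def Delineates [LinearOrder R] [TopologicalSpace R] (f : MvPolynomial (Fin (n + 1)) R)
    (S : Set (Fin n → R)) {k : ℕ} (ξ : Fin k → S → R) : Prop :=
  ∃ (m : ℕ) (hkm : k ≤ m) (μ : Fin m → ℕ),
    (∀ i, 0 < μ i) ∧
    -- over each point of `S` there are exactly `m` distinct complex roots,
    -- with multiplicities `μ₁, …, μ_m`
    (∀ a ∈ S, ∃ z : Fin m → AlgebraicClosure R, Function.Injective z ∧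
      Set.range z = complexRoots f a ∧ ∀ i, (complexFiber f a).rootMultiplicity (z i) = μ i) ∧
    -- `ξ₁ < ⋯ < ξ_k` are semi-algebraic continuous functions
    (∀ i, IsSemialgebraicFun (ξ i) ∧ Continuous (ξ i)) ∧
    (∀ i j, i < j → ∀ a, ξ i a < ξ j a) ∧
    -- `ξ_i` is a root of multiplicity `μ_i`
    (∀ i (a : S), (fiber f a).IsRoot (ξ i a) ∧
      (fiber f a).rootMultiplicity (ξ i a) = μ (Fin.castLE hkm i)) ∧
    -- every real root is one of the `ξ_i`
    (∀ (a : S) (b : R), (fiber f a).IsRoot b → ∃ i, b = ξ i a)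

/-- The roots of `f` are delineable over `S`. -/
def Delineable [LinearOrder R] [TopologicalSpace R] (f : MvPolynomial (Fin (n + 1)) R)
    (S : Set (Fin n → R)) : Prop :=
  ∃ (k : ℕ) (ξ : Fin k → S → R), Delineates f S ξ

end Delineability

end RealAlg

/-!
Over each point `a` the complex roots of `f(a, x)` vary continuously with `a`. Since the degree of
`f(a, x)` and the number of distinct roots are constant on `S`, roots can neither merge, split nor
escape to infinity: for `b` near `a`, each root of `f(a, x)` continues to exactly one root of
`f(b, x)`, with the same multiplicity, and real roots continue to real roots because the non-real
ones come in conjugate pairs (`eventually_exists_bijOn`). So the number of real roots and the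
multiplicities of all roots are locally constant on `S`, and the real roots, in increasing order,
are continuous.

Semi-algebraic connectedness makes these locally constant data constant provided that the sets on
which they take a given value are semi-algebraic. The condition that `z` is a list of all roots of
`f(a, x)` with given multiplicities, the real ones first and in increasing order, is semi-algebraic
in `a` and in the real and imaginary parts of `z`, so it remains to project away `z`; the graphs of
the real roots are projections of the same kind.

Thus the Tarski–Seidenberg theorem is needed. It is derived from the following statement
(`signDetermined`): for a finite family of polynomials in `x` with parameters, the signs of finitely
many polynomials in the parameters determine the family of sign functions on the line up to an
order isomorphism of the line. In the induction on degrees, a polynomial `p` of top degree is traded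
for its derivative and its pseudo-remainders by the other polynomials: the latter give the sign of
`p` at the zeros of the family, and between consecutive zeros `p` is monotone, so the position of
its zeros can be matched there (`exists_orderIso_sign_eq`).

The remaining ingredient is algebra over the real closed field `R`: its algebraic closure is `R[i]`
(`exists_eq_toComplex`, by Galois theory and Sylow subgroups), so that irreducible polynomials are
linear or definite quadratic, which gives the intermediate value theorem, Rolle's theorem and the
mean value theorem for polynomials.
-/

namespace RealAlg

/-! ### The algebraic closure of a real closed field -/

section Plane

variable {R : Type*} [Field R]

variable (R) in
/-- A square root of `-1` in the algebraic closure. -/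
noncomputable def imUnit : AlgebraicClosure R :=
  (IsAlgClosed.exists_pow_nat_eq (-1 : AlgebraicClosure R) (n := 2) two_pos).choose

variable (R) in
theorem imUnit_sq : imUnit R ^ 2 = -1 :=
  (IsAlgClosed.exists_pow_nat_eq (-1 : AlgebraicClosure R) (n := 2) two_pos).choose_spec

/-- The element `x + y i` of the algebraic closure. -/
noncomputable def toComplex (x y : R) : AlgebraicClosure R :=
  algebraMap R _ x + algebraMap R _ y * imUnit R

theorem toComplex_mul (x y x' y' : R) :
    toComplex x y * toComplex x' y' = toComplex (x * x' - y * y') (x * y' + y * x') := by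
  simp only [toComplex, map_sub, map_add, map_mul]
  linear_combination (algebraMap R (AlgebraicClosure R) y) * (algebraMap R _ y') * imUnit_sq R

theorem toComplex_add (x y x' y' : R) :
    toComplex x y + toComplex x' y' = toComplex (x + x') (y + y') := by
  simp only [toComplex, map_add]; ring

theorem toComplex_zero_right (x : R) : toComplex x 0 = algebraMap R _ x := by simp [toComplex]

variable [LinearOrder R] [IsStrictOrderedRing R]

theorem toComplex_eq_zero {x y : R} (h : toComplex x y = 0) : x = 0 ∧ y = 0 := by
  have h1 : toComplex x y * toComplex x (-y) = 0 := by rw [h, zero_mul]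
  rw [toComplex_mul, show x * -y + y * x = 0 by ring, toComplex_zero_right,
    FaithfulSMul.algebraMap_eq_zero_iff] at h1
  constructor <;> nlinarith [sq_nonneg x, sq_nonneg y]

theorem toComplex_injective {x y x' y' : R} (h : toComplex x y = toComplex x' y') :
    x = x' ∧ y = y' := by
  have h1 : toComplex (x - x') (y - y') = 0 := by
    have : toComplex (x - x') (y - y') = toComplex x y - toComplex x' y' := by
      simp only [toComplex, map_sub]; ring
    rw [this, h, sub_self]
  exact (toComplex_eq_zero h1).imp sub_eq_zero.1 sub_eq_zero.1

end Plane

section AlgClosure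

variable {R : Type*} [Field R] [LinearOrder R] [IsStrictOrderedRing R] [IsRealClosed R]

/-- A finite extension of odd degree is trivial: the minimal polynomial of a primitive element is
irreducible and has a root. -/
theorem finrank_eq_one_of_odd {E : Type*} [Field E] [Algebra R E] [FiniteDimensional R E]
    (h : Odd (Module.finrank R E)) : Module.finrank R E = 1 := by
  obtain ⟨α, hα⟩ := Field.exists_primitive_element R E
  rw [Field.primitive_element_iff_minpoly_natDegree_eq] at hα
  rw [← hα] at h ⊢
  obtain ⟨x, hx⟩ := IsRealClosed.exists_isRoot_of_odd_natDegree h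
  exact natDegree_eq_of_degree_eq_some (degree_eq_one_of_irreducible_of_root
    (minpoly.irreducible (Algebra.IsIntegral.isIntegral α)) hx)

theorem exists_sq_of_nonneg {x : R} (hx : 0 ≤ x) : ∃ r, 0 ≤ r ∧ r ^ 2 = x := by
  obtain ⟨s, hs⟩ := IsSquare.of_nonneg hx
  exact ⟨|s|, abs_nonneg s, by rw [sq_abs, hs, sq]⟩

/-- Every element of `R + R i` is a square in `R + R i`. -/
theorem exists_sq_eq_add_mul {L : Type*} [Field L] [Algebra R L] {i : L} (hi : i ^ 2 = -1)
    (x y : R) : ∃ u v : R, (algebraMap R L u + algebraMap R L v * i) ^ 2 =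
      algebraMap R L x + algebraMap R L y * i := by
  obtain ⟨r, hr, hr2⟩ := exists_sq_of_nonneg (add_nonneg (sq_nonneg x) (sq_nonneg y))
  have hxr : |x| ≤ r := abs_le_of_sq_le_sq (by nlinarith [sq_nonneg y]) hr
  obtain ⟨h1, h2⟩ := abs_le.1 hxr
  obtain ⟨u, hu, hu2⟩ := exists_sq_of_nonneg (x := (r + x) / 2) (by linarith)
  obtain ⟨v, hv, hv2⟩ := exists_sq_of_nonneg (x := (r - x) / 2) (by linarith)
  have key : (2 * u * v) ^ 2 = y ^ 2 := by
    calc (2 * u * v) ^ 2 = 4 * u ^ 2 * v ^ 2 := by ring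
      _ = y ^ 2 := by rw [hu2, hv2]; linear_combination hr2
  have main : ∀ w : R, w ^ 2 = v ^ 2 → 2 * u * w = y →
      (algebraMap R L u + algebraMap R L w * i) ^ 2 =
        algebraMap R L x + algebraMap R L y * i := by
    intro w hw hy
    have hx : x = u ^ 2 - w ^ 2 := by rw [hw, hu2, hv2]; ring
    rw [hx, ← hy]
    simp only [map_sub, map_mul, map_pow, map_ofNat]
    linear_combination (algebraMap R L w) ^ 2 * hi
  rcases sq_eq_sq_iff_eq_or_eq_neg.1 key with h | h
  · exact ⟨u, v, main v rfl h⟩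
  · exact ⟨u, -v, main (-v) (by ring) (by linear_combination -h)⟩

/-- `R + R i` as an intermediate field. -/
def complexSubfield {L : Type*} [Field L] [Algebra R L] {i : L} (hi : i ^ 2 = -1) :
    IntermediateField R L where
  carrier := {z | ∃ x y : R, z = algebraMap R L x + algebraMap R L y * i}
  mul_mem' := by
    rintro _ _ ⟨x, y, rfl⟩ ⟨x', y', rfl⟩
    refine ⟨x * x' - y * y', x * y' + y * x', ?_⟩
    simp only [map_sub, map_add, map_mul]
    linear_combination (algebraMap R L y) * (algebraMap R L y') * hi
  add_mem' := by
    rintro _ _ ⟨x, y, rfl⟩ ⟨x', y', rfl⟩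
    exact ⟨x + x', y + y', by simp only [map_add]; ring⟩
  algebraMap_mem' r := ⟨r, 0, by simp⟩
  inv_mem' := by
    rintro _ ⟨x, y, rfl⟩
    rcases eq_or_ne (algebraMap R L x + algebraMap R L y * i) 0 with h | h
    · exact ⟨0, 0, by simp [h]⟩
    have h0 : x ^ 2 + y ^ 2 ≠ 0 := by
      intro h0
      have hx : x = 0 := by nlinarith [sq_nonneg x, sq_nonneg y]
      have hy : y = 0 := by nlinarith [sq_nonneg x, sq_nonneg y]
      simp [hx, hy] at h
    have h0' : algebraMap R L (x ^ 2 + y ^ 2) ≠ 0 := (_root_.map_ne_zero _).2 h0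
    refine ⟨x / (x ^ 2 + y ^ 2), -y / (x ^ 2 + y ^ 2), ?_⟩
    rw [inv_eq_iff_eq_inv, eq_comm, inv_eq_iff_eq_inv, eq_comm, inv_eq_of_mul_eq_one_right]
    rw [map_div₀, map_div₀]
    field_simp
    simp only [map_add, map_neg, map_pow]
    linear_combination -(algebraMap R L y) ^ 2 * hi

/-- A finite Galois extension of `R` that contains a square root of `-1` is `R[i]`: the fixed
field of a Sylow `2`-subgroup has odd degree, so it is `R`, and the Galois group over `R[i]` is a
`2`-group; a subgroup of index two would give a quadratic extension of `R[i]`. -/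
theorem mem_complexSubfield_of_isGalois {L : Type*} [Field L] [Algebra R L]
    [FiniteDimensional R L] [IsGalois R L] {i : L} (hi : i ^ 2 = -1) (z : L) :
    z ∈ complexSubfield (R := R) hi := by
  have hchar : CharZero L := charZero_of_injective_algebraMap (algebraMap R L).injective
  set K := complexSubfield (R := R) hi
  -- the fixed field of a Sylow `2`-subgroup has odd degree
  obtain ⟨N, hN⟩ : ∃ N, Module.finrank R L = 2 ^ N := by
    let P : Sylow 2 Gal(L/R) := default
    have h1 := IntermediateField.finrank_fixedField_eq_card (F := R) (E := L) P.1
    have h2 := Module.finrank_mul_finrank R (IntermediateField.fixedField P.1) L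
    have h3 := P.1.index_mul_card
    rw [IsGalois.card_aut_eq_finrank R L, ← h2, h1] at h3
    have h4 := Nat.eq_of_mul_eq_mul_right Nat.card_pos h3
    have h5 : Odd (Module.finrank R (IntermediateField.fixedField P.1)) := by
      rw [← h4, ← Nat.not_even_iff_odd, even_iff_two_dvd]
      exact P.not_dvd_index
    rw [finrank_eq_one_of_odd h5, one_mul, h1] at h2
    obtain ⟨N, hN⟩ := (IsPGroup.iff_card (p := 2)).1 P.isPGroup'
    exact ⟨N, h2.symm.trans hN⟩
  have hKL := Module.finrank_mul_finrank R K L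
  obtain ⟨j, -, hj⟩ := (Nat.dvd_prime_pow Nat.prime_two).1
    (show Module.finrank K L ∣ 2 ^ N from ⟨_, by rw [← hN, ← hKL, mul_comm]⟩)
  rcases Nat.eq_zero_or_pos j with rfl | hjpos
  · have : (⊥ : Subalgebra K L) = ⊤ := Subalgebra.bot_eq_top_of_finrank_eq_one (by simpa using hj)
    have hz : z ∈ (⊥ : Subalgebra K L) := this ▸ Algebra.mem_top
    obtain ⟨w, rfl⟩ := Algebra.mem_bot.1 hz
    exact w.2
  exfalso
  obtain ⟨j, rfl⟩ := Nat.exists_eq_succ_of_ne_zero hjpos.ne'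
  obtain ⟨H, hH⟩ := Sylow.exists_subgroup_card_pow_prime (G := Gal(L/K)) 2 (n := j)
    (by rw [IsGalois.card_aut_eq_finrank, hj]; exact pow_dvd_pow 2 j.le_succ)
  let E := IntermediateField.fixedField H
  -- `E` is a quadratic extension of `R + R i`, but discriminants are squares there
  have hE : Module.finrank K E = 2 := by
    have h1 := IntermediateField.finrank_fixedField_eq_card (F := K) (E := L) H
    have h2 := Module.finrank_mul_finrank K E L
    rw [h1, hH, hj, pow_succ'] at h2
    exact Nat.eq_of_mul_eq_mul_right (by positivity) h2
  obtain ⟨α, hα⟩ := Field.exists_primitive_element K E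
  rw [Field.primitive_element_iff_minpoly_natDegree_eq, hE] at hα
  have hint : IsIntegral K α := Algebra.IsIntegral.isIntegral α
  have hirr := minpoly.irreducible hint
  have hmon := minpoly.monic hint
  have hsq : ∀ w : K, ∃ s : K, w = s * s := by
    rintro ⟨_, x, y, rfl⟩
    obtain ⟨u, v, huv⟩ := exists_sq_eq_add_mul hi x y
    exact ⟨⟨_, u, v, rfl⟩, Subtype.ext (huv.symm.trans (sq _))⟩
  obtain ⟨x, hx⟩ := exists_quadratic_eq_zero (a := (1 : K)) (b := (minpoly K α).coeff 1)
    (c := (minpoly K α).coeff 0) one_ne_zero (hsq _)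
  have hroot : (minpoly K α).IsRoot x := by
    have h2 : (minpoly K α).coeff 2 = 1 := by
      rw [← hα]; exact hmon.coeff_natDegree
    rw [IsRoot, eval_eq_sum_range, hα]
    simp only [Finset.sum_range_succ, Finset.sum_range_zero, h2]
    linear_combination hx
  have h1 := natDegree_eq_of_degree_eq_some (degree_eq_one_of_irreducible_of_root hirr hroot)
  exact absurd (hα.symm.trans h1) (by decide)

/-- The algebraic closure of a real closed field is `R[i]`. -/
theorem exists_eq_toComplex (z : AlgebraicClosure R) : ∃ x y : R, z = toComplex x y := by
  let F := IntermediateField.adjoin R {imUnit R, z}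
  have : FiniteDimensional R F := IntermediateField.finiteDimensional_adjoin fun x _ =>
    Algebra.IsIntegral.isIntegral x
  let L := IntermediateField.normalClosure R F (AlgebraicClosure R)
  have hFL : F ≤ L := F.le_normalClosure
  have : IsGalois R L := { }
  have h1 : imUnit R ∈ L := hFL (IntermediateField.subset_adjoin _ _ (by simp))
  have h2 : z ∈ L := hFL (IntermediateField.subset_adjoin _ _ (by simp))
  obtain ⟨x, y, h⟩ := mem_complexSubfield_of_isGalois (R := R) (i := (⟨_, h1⟩ : L))
    (Subtype.ext (imUnit_sq R)) ⟨z, h2⟩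
  exact ⟨x, y, congrArg Subtype.val h⟩

/-- The algebraic closure as the plane `R × R`. -/
noncomputable def planeEquiv (R : Type*) [Field R] [LinearOrder R] [IsStrictOrderedRing R]
    [IsRealClosed R] : R × R ≃ AlgebraicClosure R :=
  Equiv.ofBijective (fun p => toComplex p.1 p.2)
    ⟨fun _ _ h => Prod.ext (toComplex_injective h).1 (toComplex_injective h).2,
      fun z => let ⟨x, y, h⟩ := exists_eq_toComplex z; ⟨(x, y), h.symm⟩⟩

/-- The real part. -/
noncomputable def re (z : AlgebraicClosure R) : R := ((planeEquiv R).symm z).1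

/-- The imaginary part. -/
noncomputable def im (z : AlgebraicClosure R) : R := ((planeEquiv R).symm z).2

@[simp] theorem toComplex_re_im (z : AlgebraicClosure R) : toComplex (re z) (im z) = z :=
  (planeEquiv R).apply_symm_apply z

theorem planeEquiv_symm_toComplex (x y : R) : (planeEquiv R).symm (toComplex x y) = (x, y) :=
  (planeEquiv R).symm_apply_apply (x, y)

@[simp] theorem re_toComplex (x y : R) : re (toComplex x y) = x := by
  rw [re, planeEquiv_symm_toComplex]

@[simp] theorem im_toComplex (x y : R) : im (toComplex x y) = y := by
  rw [im, planeEquiv_symm_toComplex]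

theorem complex_ext {z w : AlgebraicClosure R} (h1 : re z = re w) (h2 : im z = im w) : z = w := by
  rw [← toComplex_re_im z, h1, h2, toComplex_re_im]

@[simp] theorem re_algebraMap (x : R) : re (algebraMap R (AlgebraicClosure R) x) = x := by
  rw [← toComplex_zero_right, re_toComplex]

@[simp] theorem im_algebraMap (x : R) : im (algebraMap R (AlgebraicClosure R) x) = 0 := by
  rw [← toComplex_zero_right, im_toComplex]

@[simp] theorem re_add (z w : AlgebraicClosure R) : re (z + w) = re z + re w := by
  conv_lhs => rw [← toComplex_re_im z, ← toComplex_re_im w, toComplex_add, re_toComplex]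

@[simp] theorem im_add (z w : AlgebraicClosure R) : im (z + w) = im z + im w := by
  conv_lhs => rw [← toComplex_re_im z, ← toComplex_re_im w, toComplex_add, im_toComplex]

@[simp] theorem re_mul (z w : AlgebraicClosure R) : re (z * w) = re z * re w - im z * im w := by
  conv_lhs => rw [← toComplex_re_im z, ← toComplex_re_im w, toComplex_mul, re_toComplex]

@[simp] theorem im_mul (z w : AlgebraicClosure R) : im (z * w) = re z * im w + im z * re w := by
  conv_lhs => rw [← toComplex_re_im z, ← toComplex_re_im w, toComplex_mul, im_toComplex]

theorem im_eq_zero_iff {z : AlgebraicClosure R} : im z = 0 ↔ algebraMap R _ (re z) = z := by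
  constructor
  · intro h
    exact complex_ext (by simp) (by simp [h])
  · intro h
    rw [← h, im_algebraMap]

variable (R) in
/-- Complex conjugation. -/
noncomputable def complexConj : AlgebraicClosure R →ₐ[R] AlgebraicClosure R where
  toFun z := toComplex (re z) (-im z)
  map_one' := by
    rw [← map_one (algebraMap R (AlgebraicClosure R))]
    exact complex_ext (by simp) (by rw [im_toComplex, im_algebraMap, neg_zero])
  map_zero' := by
    rw [← map_zero (algebraMap R (AlgebraicClosure R))]
    exact complex_ext (by simp) (by rw [im_toComplex, im_algebraMap, neg_zero])
  map_mul' z w := complex_ext (by simp) (by simp; ring)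
  map_add' z w := complex_ext (by simp) (by simp; ring)
  commutes' x := complex_ext (by simp) (by simp)

@[simp] theorem re_complexConj (z : AlgebraicClosure R) : re (complexConj R z) = re z :=
  re_toComplex _ _

@[simp] theorem im_complexConj (z : AlgebraicClosure R) : im (complexConj R z) = -im z :=
  im_toComplex _ _

variable (R) in
/-- The square `x² + y²` of the absolute value of `x + y i`. -/
noncomputable def normSq : AlgebraicClosure R →* R where
  toFun z := re z ^ 2 + im z ^ 2
  map_one' := by
    rw [← map_one (algebraMap R (AlgebraicClosure R)), re_algebraMap, im_algebraMap]; simp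
  map_mul' z w := by simp only [re_mul, im_mul]; ring

theorem normSq_apply (z : AlgebraicClosure R) : normSq R z = re z ^ 2 + im z ^ 2 := rfl

theorem normSq_nonneg (z : AlgebraicClosure R) : 0 ≤ normSq R z :=
  add_nonneg (sq_nonneg _) (sq_nonneg _)

theorem normSq_eq_zero {z : AlgebraicClosure R} : normSq R z = 0 ↔ z = 0 := by
  constructor
  · intro h
    rw [normSq_apply] at h
    have h1 : re z = 0 := by nlinarith [sq_nonneg (re z), sq_nonneg (im z)]
    have h2 : im z = 0 := by nlinarith [sq_nonneg (re z), sq_nonneg (im z)]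
    rw [← toComplex_re_im z, h1, h2]; simp [toComplex]
  · rintro rfl
    rw [normSq_apply, ← map_zero (algebraMap R (AlgebraicClosure R)), re_algebraMap,
      im_algebraMap]
    simp

end AlgClosure

/-! ### Univariate polynomials over a real closed field -/

section Univariate

variable {R : Type*} [Field R] [LinearOrder R] [IsStrictOrderedRing R] [IsRealClosed R]

/-- A real polynomial with a non-real root `x + y i` is divisible by `(X - x)² + y²`. -/
theorem quadratic_dvd {p : R[X]} {z : AlgebraicClosure R} (hz : im z ≠ 0)
    (hp : aeval z p = 0) : (X - C (re z)) ^ 2 + C (im z ^ 2) ∣ p := by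
  set q : R[X] := (X - C (re z)) ^ 2 + C (im z ^ 2) with hq
  have hdeg : q.natDegree = 2 := by
    rw [hq]; compute_degree!
  have hmon : q.Monic := by
    rw [hq]; monicity!
  have hqz : aeval z q = 0 := by
    have h1 : (z - algebraMap R _ (re z)) = algebraMap R _ (im z) * imUnit R := by
      rw [sub_eq_iff_eq_add']
      exact (toComplex_re_im z).symm
    simp only [hq, map_add, map_pow, map_sub, aeval_X, aeval_C]
    rw [h1]
    linear_combination (algebraMap R (AlgebraicClosure R) (im z)) ^ 2 * imUnit_sq R
  rw [← modByMonic_eq_zero_iff_dvd hmon]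
  set r := p %ₘ q
  have hr : aeval z r = 0 := by
    have := congrArg (aeval z) (modByMonic_add_div p q)
    rwa [map_add, map_mul, hqz, zero_mul, add_zero, hp] at this
  have hrd : r.natDegree ≤ 1 := by
    have := natDegree_modByMonic_lt p hmon (by intro h; rw [h] at hdeg; simp at hdeg)
    rw [hdeg] at this
    exact Nat.le_of_lt_succ this
  rw [eq_X_add_C_of_natDegree_le_one hrd] at hr
  simp only [map_add, map_mul, aeval_X, aeval_C] at hr
  have h1 := congrArg im hr
  have h2 := congrArg re hr
  rw [← map_zero (algebraMap R (AlgebraicClosure R))] at h1 h2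
  simp only [im_add, im_mul, re_add, re_mul, re_algebraMap, im_algebraMap] at h1 h2
  have h3 : r.coeff 1 = 0 := by
    rcases mul_eq_zero.1 (show r.coeff 1 * im z = 0 by linear_combination h1) with h | h
    · exact h
    · exact absurd h hz
  have h4 : r.coeff 0 = 0 := by rw [h3] at h2; linear_combination h2
  rw [eq_X_add_C_of_natDegree_le_one hrd, h3, h4]; simp

/-- A polynomial without zeros on an interval takes values of the same sign at its ends: this holds
for its linear and quadratic factors. -/
theorem eval_mul_eval_pos_of_ne_zero {p : R[X]} {a b : R} (hab : a ≤ b)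
    (h : ∀ x ∈ Set.Icc a b, p.eval x ≠ 0) : 0 < p.eval a * p.eval b := by
  induction hd : p.natDegree using Nat.strong_induction_on generalizing p with
  | _ d ih =>
    rcases Nat.eq_zero_or_pos d with rfl | hpos
    · rw [eq_C_of_natDegree_eq_zero hd] at h ⊢
      have := h a ⟨le_rfl, hab⟩
      simp only [eval_C] at this ⊢
      exact mul_self_pos.2 this
    have hp0 : p ≠ 0 := by rintro rfl; simp at hd; omega
    obtain ⟨z, hz⟩ := IsAlgClosed.exists_aeval_eq_zero (AlgebraicClosure R) p
      (ne_of_gt (natDegree_pos_iff_degree_pos.1 (hd ▸ hpos)))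
    have step : ∀ q : R[X], 0 < q.natDegree → q ∣ p → 0 < q.eval a * q.eval b →
        0 < p.eval a * p.eval b := by
      rintro q hq ⟨g, rfl⟩ hpos
      have hg := ih g.natDegree (by
        rw [← hd, natDegree_mul (left_ne_zero_of_mul hp0) (right_ne_zero_of_mul hp0)]; omega)
        (p := g) (fun x hx h0 => h x hx (by simp [h0])) rfl
      simp only [eval_mul]
      nlinarith [mul_pos hpos hg]
    by_cases him : im z = 0
    · have hroot : p.IsRoot (re z) := by
        rw [im_eq_zero_iff] at him
        rw [← him, aeval_algebraMap_apply, FaithfulSMul.algebraMap_eq_zero_iff] at hz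
        simpa using hz
      refine step (X - C (re z)) (by simp) (dvd_iff_isRoot.2 hroot) ?_
      have hnot : ¬ (a ≤ re z ∧ re z ≤ b) := fun hh => h _ hh hroot
      simp only [eval_sub, eval_X, eval_C]
      rcases not_and_or.1 hnot with hh | hh
      · exact mul_pos (by linarith) (by linarith)
      · exact mul_pos_of_neg_of_neg (by linarith) (by linarith)
    · refine step _ ?_ (quadratic_dvd him hz) ?_
      · rw [show ((X - C (re z)) ^ 2 + C (im z ^ 2) : R[X]).natDegree = 2 by compute_degree!]
        norm_num
      · simp only [eval_add, eval_pow, eval_sub, eval_X, eval_C]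
        have := sq_pos_of_ne_zero him
        positivity

/-- The intermediate value theorem for polynomials. -/
theorem exists_eval_eq_zero {p : R[X]} {a b : R} (hab : a ≤ b)
    (h : p.eval a * p.eval b ≤ 0) : ∃ x ∈ Set.Icc a b, p.eval x = 0 := by
  by_contra! hne
  exact h.not_gt (eval_mul_eval_pos_of_ne_zero hab hne)

/-- Rolle's theorem for consecutive roots: with `p = (X - a)ᵐ (X - b)ⁿ g`, the derivative is
`(X - a)ᵐ⁻¹ (X - b)ⁿ⁻¹` times a polynomial whose values at `a` and `b` have opposite signs. -/
theorem exists_derivative_eq_zero_of_consecutive {p : R[X]} (hp : p ≠ 0) {a b : R} (hab : a < b)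
    (ha : p.eval a = 0) (hb : p.eval b = 0) (h : ∀ x ∈ Set.Ioo a b, p.eval x ≠ 0) :
    ∃ x ∈ Set.Ioo a b, p.derivative.eval x = 0 := by
  obtain ⟨q, hq, hqa⟩ := exists_eq_pow_rootMultiplicity_mul_and_not_dvd p hp a
  have hq0 : q ≠ 0 := by rintro rfl; simp at hqa
  obtain ⟨g, hg, hgb⟩ := exists_eq_pow_rootMultiplicity_mul_and_not_dvd q hq0 b
  obtain ⟨m, hm⟩ := Nat.exists_eq_succ_of_ne_zero ((rootMultiplicity_pos hp).2 ha).ne'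
  have hqb : q.eval b = 0 := by
    rw [hq, eval_mul] at hb
    refine (mul_eq_zero.1 hb).resolve_left ?_
    rw [eval_pow, eval_sub, eval_X, eval_C]
    exact pow_ne_zero _ (sub_ne_zero.2 hab.ne')
  obtain ⟨n, hn⟩ := Nat.exists_eq_succ_of_ne_zero ((rootMultiplicity_pos hq0).2 hqb).ne'
  rw [hm] at hq
  rw [hn] at hg
  rw [dvd_iff_isRoot, IsRoot] at hqa hgb
  have hga : g.eval a ≠ 0 := fun h0 => hqa (by rw [hg]; simp [h0])
  have hgab : 0 < g.eval a * g.eval b := by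
    refine eval_mul_eval_pos_of_ne_zero hab.le fun x hx h0 => ?_
    rcases eq_or_lt_of_le hx.1 with rfl | h1
    · exact hga h0
    rcases eq_or_lt_of_le hx.2 with rfl | h2
    · exact hgb h0
    · exact h x ⟨h1, h2⟩ (by rw [hq, hg]; simp [h0])
  set s : R[X] := C ((m : R) + 1) * (X - C b) * g + C ((n : R) + 1) * (X - C a) * g +
    (X - C a) * (X - C b) * g.derivative with hs
  have hder : p.derivative = (X - C a) ^ m * (X - C b) ^ n * s := by
    rw [hq, hg, hs]
    simp only [derivative_mul, derivative_X_sub_C_pow, Nat.succ_eq_add_one, Nat.add_sub_cancel,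
      Nat.cast_add, Nat.cast_one, map_add, map_one, map_natCast]
    ring
  have hsab : s.eval a * s.eval b < 0 := by
    have h1 : s.eval a * s.eval b =
        -(((m : R) + 1) * ((n : R) + 1) * (b - a) ^ 2 * (g.eval a * g.eval b)) := by
      simp [hs]; ring
    rw [h1, neg_lt_zero]
    have := sub_pos.2 hab
    positivity
  obtain ⟨x, hx, hx0⟩ := exists_eval_eq_zero hab.le hsab.le
  refine ⟨x, ⟨lt_of_le_of_ne hx.1 ?_, lt_of_le_of_ne hx.2 ?_⟩, by rw [hder]; simp [hx0]⟩
  · rintro rfl; simp [hx0] at hsab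
  · rintro rfl; simp [hx0] at hsab

/-- Rolle's theorem for polynomials. -/
theorem exists_derivative_eq_zero {p : R[X]} {a b : R} (hab : a < b)
    (ha : p.eval a = 0) (hb : p.eval b = 0) : ∃ x ∈ Set.Ioo a b, p.derivative.eval x = 0 := by
  rcases eq_or_ne p 0 with rfl | hp
  · exact ⟨(a + b) / 2, ⟨by linarith, by linarith⟩, by simp⟩
  -- the least root above `a`
  have hne : (p.roots.toFinset.filter (a < ·)).Nonempty := ⟨b, by simp [hp, hb, hab]⟩
  have hc := Finset.min'_mem _ hne
  set c := Finset.min' _ hne with hcdef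
  simp only [Finset.mem_filter, Multiset.mem_toFinset, mem_roots hp, IsRoot] at hc
  have hcb : c ≤ b := Finset.min'_le _ _ (by simp [hp, hb, hab])
  obtain ⟨x, hx, hx0⟩ := exists_derivative_eq_zero_of_consecutive hp hc.2 ha hc.1
    fun x hx h0 => (Finset.min'_le (p.roots.toFinset.filter (a < ·)) x
      (by simp [hp, h0, hx.1])).not_gt hx.2
  exact ⟨x, ⟨hx.1, hx.2.trans_le hcb⟩, hx0⟩

/-- The mean value theorem for polynomials. -/
theorem exists_derivative_mul_eq {p : R[X]} {a b : R} (hab : a < b) :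
    ∃ x ∈ Set.Ioo a b, p.derivative.eval x * (b - a) = p.eval b - p.eval a := by
  obtain ⟨x, hx, h⟩ := exists_derivative_eq_zero (p := C (b - a) * (p - C (p.eval a)) -
    C (p.eval b - p.eval a) * (X - C a)) hab (by simp) (by simp; ring)
  refine ⟨x, hx, ?_⟩
  simp at h
  linear_combination h

theorem sign_eval_eq_of_ne_zero {p : R[X]} {a b : R}
    (h : ∀ x ∈ Set.uIcc a b, p.eval x ≠ 0) :
    SignType.sign (p.eval a) = SignType.sign (p.eval b) := by
  have key : ∀ {a b : R}, a ≤ b → (∀ x ∈ Set.Icc a b, p.eval x ≠ 0) →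
      SignType.sign (p.eval a) = SignType.sign (p.eval b) := by
    intro a b hab h
    rcases pos_and_pos_or_neg_and_neg_of_mul_pos (eval_mul_eval_pos_of_ne_zero hab h) with h | h
    · rw [sign_pos h.1, sign_pos h.2]
    · rw [sign_neg h.1, sign_neg h.2]
  rcases le_total a b with hab | hab
  · exact key hab (by rwa [Set.uIcc_of_le hab] at h)
  · exact (key hab (by rwa [Set.uIcc_of_ge hab] at h)).symm

end Univariate

/-! ### Order isomorphisms matching the signs of polynomials -/

section Component

variable {R : Type*} [LinearOrder R]

/-- The points `x` and `y` lie in the same component of the complement of `Z`. -/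
def SameComponent (Z : Finset R) (x y : R) : Prop := ∀ z ∈ Z, z ∉ Set.uIcc x y

variable {Z : Finset R} {x y w : R}

theorem SameComponent.symm (h : SameComponent Z x y) : SameComponent Z y x := fun z hz => by
  rw [Set.uIcc_comm]; exact h z hz

theorem SameComponent.trans (h : SameComponent Z x y) (h' : SameComponent Z y w) :
    SameComponent Z x w := fun z hz hzx =>
  (Set.uIcc_subset_uIcc_union_uIcc hzx).elim (h z hz) (h' z hz)

theorem SameComponent.left_notMem (h : SameComponent Z x y) : x ∉ Z := fun hx =>
  h x hx Set.left_mem_uIcc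

theorem SameComponent.of_mem_uIcc (h : SameComponent Z x y) (hw : w ∈ Set.uIcc x y) :
    SameComponent Z x w := fun z hz hzx =>
  h z hz (Set.uIcc_subset_uIcc Set.left_mem_uIcc hw hzx)

end Component

section Moving

variable {R : Type*} [Field R] [LinearOrder R] [IsStrictOrderedRing R]

/-- The pointwise maximum of two order isomorphisms. -/
def maxIso (e₁ e₂ : R ≃o R) : R ≃o R where
  toFun x := max (e₁ x) (e₂ x)
  invFun y := min (e₁.symm y) (e₂.symm y)
  left_inv x := by
    rcases le_total (e₁ x) (e₂ x) with h | h
    · simp only [max_eq_right h, OrderIso.symm_apply_apply]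
      exact min_eq_right (by rwa [OrderIso.le_symm_apply])
    · simp only [max_eq_left h, OrderIso.symm_apply_apply]
      exact min_eq_left (by rwa [OrderIso.le_symm_apply])
  right_inv y := by
    rcases le_total (e₁.symm y) (e₂.symm y) with h | h
    · simp only [min_eq_left h, OrderIso.apply_symm_apply]
      exact max_eq_left (by rwa [← OrderIso.le_symm_apply])
    · simp only [min_eq_right h, OrderIso.apply_symm_apply]
      exact max_eq_right (by rwa [← OrderIso.le_symm_apply])
  map_rel_iff' {x y} := by
    refine ⟨fun h => ?_, fun h => max_le_max (e₁.monotone h) (e₂.monotone h)⟩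
    by_contra! hlt
    exact h.not_gt (max_lt_max (e₁.strictMono hlt) (e₂.strictMono hlt))

/-- The homothety with centre `c` and ratio `s > 0`. -/
def homothety (c s : R) (hs : 0 < s) : R ≃o R where
  toFun x := c + s * (x - c)
  invFun y := c + s⁻¹ * (y - c)
  left_inv x := by simp [hs.ne']
  right_inv x := by simp [hs.ne']
  map_rel_iff' := by simp [hs]

/-- A piecewise affine order isomorphism, the identity outside `(l, u)`, moving `t` up to `t'`. -/
theorem exists_orderIso_move {l t t' u : R} (h1 : l < t) (h2 : t < t') (h3 : t' < u) :
    ∃ θ : R ≃o R, θ t = t' ∧ (∀ y ≤ l, θ y = y) ∧ ∀ y, u ≤ y → θ y = y := by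
  have hl : 0 < t - l := sub_pos.2 h1
  have hu : 0 < u - t := by linarith
  let e₁ := homothety l ((t' - l) / (t - l)) (div_pos (by linarith) hl)
  let e₂ := homothety u ((u - t') / (u - t)) (div_pos (by linarith) hu)
  have he₁ : ∀ x, e₁ x = l + (t' - l) / (t - l) * (x - l) := fun _ => rfl
  have he₂ : ∀ x, e₂ x = u + (u - t') / (u - t) * (x - u) := fun _ => rfl
  -- `min e₁ e₂` is concave, passes through `(t, t')`, and meets the diagonal in `l` and `u`
  let θ := maxIso (OrderIso.refl R) (maxIso e₁.symm e₂.symm).symm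
  have hθ : ∀ x, θ x = max x (min (e₁ x) (e₂ x)) := fun _ => rfl
  refine ⟨θ, ?_, fun y hy => ?_, fun y hy => ?_⟩
  · have h4 : e₁ t = t' := by rw [he₁]; field_simp; ring
    have h5 : e₂ t = t' := by rw [he₂]; field_simp; ring
    rw [hθ, h4, h5, min_self, max_eq_right h2.le]
  · rw [hθ]
    refine max_eq_left (min_le_of_left_le ?_)
    have : 1 ≤ (t' - l) / (t - l) := (one_le_div hl).2 (by linarith)
    rw [he₁]; nlinarith
  · rw [hθ]
    refine max_eq_left (min_le_of_right_le ?_)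
    have : (u - t') / (u - t) ≤ 1 := (div_le_one hu).2 (by linarith)
    rw [he₂]; nlinarith

variable {Z : Finset R}

/-- There is a gap of `Z` above any point. -/
theorem exists_gt_forall_notMem (Z : Finset R) (t : R) :
    ∃ u, t < u ∧ ∀ z ∈ Z, t < z → u < z := by
  induction Z using Finset.induction_on with
  | empty => exact ⟨t + 1, by linarith, by simp⟩
  | insert a Z _ ih =>
    obtain ⟨u, hu, h⟩ := ih
    by_cases ha : t < a
    · refine ⟨min u ((t + a) / 2), lt_min hu (by linarith), fun z hz hz' => ?_⟩
      rcases Finset.mem_insert.1 hz with rfl | hz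
      · exact min_lt_of_right_lt (by linarith)
      · exact min_lt_of_left_lt (h z hz hz')
    · refine ⟨u, hu, fun z hz hz' => ?_⟩
      rcases Finset.mem_insert.1 hz with rfl | hz
      · exact absurd hz' ha
      · exact h z hz hz'

/-- There is a gap of `Z` below any point. -/
theorem exists_lt_forall_notMem (Z : Finset R) (t : R) :
    ∃ l, l < t ∧ ∀ z ∈ Z, z < t → z < l := by
  obtain ⟨u, hu, h⟩ := exists_gt_forall_notMem (Z.image (fun z => -z)) (-t)
  refine ⟨-u, by linarith, fun z hz hzt => ?_⟩
  have := h (-z) (Finset.mem_image_of_mem _ hz) (by linarith)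
  linarith

/-- A point can be moved within its component without moving any point of another component. -/
theorem SameComponent.exists_orderIso {t t' : R} (h : SameComponent Z t t') :
    ∃ θ : R ≃o R, θ t = t' ∧ ∀ y, ¬ SameComponent Z y t → θ y = y := by
  have key : ∀ {t t' : R}, t < t' → SameComponent Z t t' →
      ∃ θ : R ≃o R, θ t = t' ∧ ∀ y, ¬ SameComponent Z y t → θ y = y := by
    intro t t' hlt h
    obtain ⟨u, hu, hZu⟩ := exists_gt_forall_notMem Z t'
    obtain ⟨l, hl, hZl⟩ := exists_lt_forall_notMem Z t
    obtain ⟨θ, h1, h2, h3⟩ := exists_orderIso_move hl hlt hu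
    refine ⟨θ, h1, fun y hy => ?_⟩
    rcases le_or_gt y l with hyl | hyl
    · exact h2 y hyl
    rcases le_or_gt u y with hyu | hyu
    · exact h3 y hyu
    refine absurd (fun z hz hzy => ?_) hy
    have hz1 : z ∉ Set.Icc t t' := by rw [← Set.uIcc_of_le hlt.le]; exact h z hz
    obtain ⟨h4, h5⟩ := Set.mem_Icc.1 hzy
    have hlz : l < z := lt_of_lt_of_le (lt_min hyl hl) h4
    have hzu : z < u := lt_of_le_of_lt h5 (max_lt hyu (hlt.trans hu))
    rcases lt_or_ge z t with h6 | h6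
    · exact (hZl z hz h6).not_gt hlz
    rcases le_or_gt z t' with h7 | h7
    · exact hz1 ⟨h6, h7⟩
    · exact (hZu z hz h7).not_gt hzu
  rcases lt_trichotomy t t' with hlt | rfl | hlt
  · exact key hlt h
  · exact ⟨OrderIso.refl R, rfl, fun _ _ => rfl⟩
  · obtain ⟨θ, h1, h2⟩ := key hlt h.symm
    refine ⟨θ.symm, by rw [OrderIso.symm_apply_eq, h1], fun y hy => ?_⟩
    rw [OrderIso.symm_apply_eq, h2 y fun h' => hy (h'.trans h.symm)]

/-- Finitely many points in different components of the complement of `Z` can be moved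
simultaneously within their components. -/
theorem exists_orderIso_moves (T : Finset R) (g : R → R)
    (hg : ∀ t ∈ T, SameComponent Z t (g t))
    (hT : ∀ s ∈ T, ∀ t ∈ T, SameComponent Z s t → s = t) :
    ∃ θ : R ≃o R, (∀ t ∈ T, θ t = g t) ∧ ∀ y, (∀ t ∈ T, ¬ SameComponent Z y t) → θ y = y := by
  induction T using Finset.induction_on with
  | empty => exact ⟨OrderIso.refl R, by simp, fun _ _ => rfl⟩
  | insert a T haT ih =>
    obtain ⟨θ, h1, h2⟩ := ih (fun t ht => hg t (Finset.mem_insert_of_mem ht))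
      (fun s hs t ht => hT s (Finset.mem_insert_of_mem hs) t (Finset.mem_insert_of_mem ht))
    obtain ⟨μ, h3, h4⟩ := (hg a (Finset.mem_insert_self a T)).exists_orderIso
    refine ⟨θ.trans μ, fun t ht => ?_, fun y hy => ?_⟩
    · rcases Finset.mem_insert.1 ht with rfl | ht'
      · rw [OrderIso.trans_apply, h2 t fun s hs hts => haT ?_, h3]
        rwa [hT t ht s (Finset.mem_insert_of_mem hs) hts]
      · rw [OrderIso.trans_apply, h1 t ht', h4]
        intro hc
        exact haT (hT t ht a (Finset.mem_insert_self a T) ((hg t ht).trans hc) ▸ ht')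
    · rw [OrderIso.trans_apply, h2 y fun t ht => hy t (Finset.mem_insert_of_mem ht),
        h4 y (hy a (Finset.mem_insert_self a T))]

end Moving

section PiecewiseMonotone

variable {R : Type*} [Field R] [LinearOrder R] [IsStrictOrderedRing R]

open SignType

/-- The features of a non-constant polynomial function `h` that its sign pattern depends on, where
`σ` is the sign of the derivative. Reparametrizing by an order isomorphism preserves them. -/
structure PolyLike (σ : R → SignType) (h : R → R) : Prop where
  mean_value : ∀ x y, x < y → ∃ c ∈ Set.Ioo x y, sign (h y - h x) = σ c
  intermediate_value : ∀ x y, x ≤ y → h x * h y ≤ 0 → ∃ c ∈ Set.Icc x y, h c = 0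
  unbounded_above : ∀ M K, ∃ y, M < y ∧ K < |h y|
  unbounded_below : ∀ M K, ∃ y, y < M ∧ K < |h y|

variable {σ : R → SignType} {h h₁ h₂ : R → R} {Z : Finset R}

theorem PolyLike.comp_neg (H : PolyLike σ h) :
    PolyLike (fun x => -σ (-x)) (fun x => h (-x)) where
  mean_value x y hxy := by
    obtain ⟨c, hc, h1⟩ := H.mean_value (-y) (-x) (by linarith)
    refine ⟨-c, ⟨by linarith [hc.2], by linarith [hc.1]⟩, ?_⟩
    rw [neg_neg, ← h1, ← Left.sign_neg, neg_sub]
  intermediate_value x y hxy hle := by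
    obtain ⟨c, hc, h1⟩ := H.intermediate_value (-y) (-x) (by linarith) (by rwa [mul_comm])
    exact ⟨-c, ⟨by linarith [hc.2], by linarith [hc.1]⟩, by simpa using h1⟩
  unbounded_above M K := by
    obtain ⟨y, h1, h2⟩ := H.unbounded_below (-M) K
    exact ⟨-y, by linarith, by simpa using h2⟩
  unbounded_below M K := by
    obtain ⟨y, h1, h2⟩ := H.unbounded_above (-M) K
    exact ⟨-y, by linarith, by simpa using h2⟩

omit [IsStrictOrderedRing R] in
theorem PolyLike.sign_sub (H : PolyLike σ h) {x y : R}
    (hσ : ∀ c ∈ Set.Ioo x y, σ c = σ x) (hxy : x < y) : sign (h y - h x) = σ x := by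
  obtain ⟨c, hc, h1⟩ := H.mean_value x y hxy
  rw [h1, hσ c hc]

theorem sign_eq_of_mul_pos {a b : R} (h : 0 < a * b) : sign a = sign b := by
  rcases pos_and_pos_or_neg_and_neg_of_mul_pos h with h | h
  · rw [sign_pos h.1, sign_pos h.2]
  · rw [sign_neg h.1, sign_neg h.2]

theorem sign_sub_eq_of_abs_lt {a b : R} (h : |b| < |a|) : sign (a - b) = sign a := by
  obtain ⟨h1, h2⟩ := abs_lt.1 h
  rcases le_total 0 a with ha | ha
  · rw [abs_of_nonneg ha] at h1 h2
    rw [sign_pos (by linarith), sign_pos (by linarith)]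
  · rw [abs_of_nonpos ha] at h1 h2
    rw [sign_neg (by linarith), sign_neg (by linarith)]

/-- The sign towards the right end of the component of `t` is the same for two functions that have
the same signs on `Z` and the same sign of the derivative: it is the sign at the next point `u` of
`Z`, the opposite of the sign of the derivative if `h u = 0`, and the sign of the derivative if
there is no such `u`. -/
theorem exists_sign_right (hσ : ∀ x y, SameComponent Z x y → σ x = σ y) {t : R} (ht : t ∉ Z)
    (hσt : σ t ≠ 0) (H₁ : PolyLike σ h₁) (H₂ : PolyLike σ h₂)
    (hZ : ∀ z ∈ Z, sign (h₁ z) = sign (h₂ z)) :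
    ∃ ρ : SignType, ρ ≠ 0 ∧
      (∃ x, t ≤ x ∧ SameComponent Z t x ∧ sign (h₁ x) = ρ) ∧
      ∃ x, t ≤ x ∧ SameComponent Z t x ∧ sign (h₂ x) = ρ := by
  suffices hs : ∃ ρ : SignType, ρ ≠ 0 ∧ ∀ h, PolyLike σ h → (∀ z ∈ Z, sign (h₁ z) = sign (h z)) →
      ∃ x, t ≤ x ∧ SameComponent Z t x ∧ sign (h x) = ρ by
    obtain ⟨ρ, h0, hρ⟩ := hs
    exact ⟨ρ, h0, hρ h₁ H₁ fun _ _ => rfl, hρ h₂ H₂ hZ⟩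
  rcases (Z.filter (t < ·)).eq_empty_or_nonempty with he | hne
  · refine ⟨σ t, hσt, fun h H _ => ?_⟩
    have hsame : ∀ y, t ≤ y → SameComponent Z t y := fun y hty z hz hzy => by
      rw [Set.uIcc_of_le hty] at hzy
      have : z ∈ Z.filter (t < ·) :=
        Finset.mem_filter.2 ⟨hz, lt_of_le_of_ne hzy.1 fun h => ht (h ▸ hz)⟩
      simp [he] at this
    obtain ⟨y, hty, hy⟩ := H.unbounded_above t |h t|
    refine ⟨y, hty.le, hsame y hty.le, ?_⟩
    rw [← sign_sub_eq_of_abs_lt hy]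
    exact H.sign_sub (fun c hc => (hσ _ _ (hsame c hc.1.le)).symm) hty
  · have hu := Finset.min'_mem _ hne
    have hmin : ∀ z ∈ Z.filter (t < ·), Finset.min' _ hne ≤ z := fun z hz =>
      Finset.min'_le (Z.filter (t < ·)) z hz
    generalize Finset.min' _ hne = u at hu hmin
    obtain ⟨huZ, htu⟩ := Finset.mem_filter.1 hu
    have hsame : ∀ y, t ≤ y → y < u → SameComponent Z t y := fun y hty hyu z hz hzy => by
      rw [Set.uIcc_of_le hty] at hzy
      exact (hmin z (Finset.mem_filter.2 ⟨hz, lt_of_le_of_ne hzy.1 fun h => ht (h ▸ hz)⟩)).not_gt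
        (hzy.2.trans_lt hyu)
    have hsub : ∀ h, PolyLike σ h → ∀ x, t ≤ x → x < u → sign (h u - h x) = σ t := by
      intro h H x htx hxu
      rw [H.sign_sub (fun c hc => ?_) hxu, hσ _ _ (hsame x htx hxu)]
      rw [← hσ _ _ (hsame c (htx.trans hc.1.le) hc.2), ← hσ _ _ (hsame x htx hxu)]
    by_cases h0 : h₁ u = 0
    · refine ⟨-σ t, by simpa using hσt, fun h H hh => ⟨t, le_rfl, hsame t le_rfl htu, ?_⟩⟩
      have hu0 : h u = 0 := by
        have := hh u huZ
        rwa [h0, sign_zero, eq_comm, sign_eq_zero_iff] at this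
      have := hsub h H t le_rfl htu
      rw [hu0, zero_sub, Left.sign_neg] at this
      rw [← this, neg_neg]
    · refine ⟨sign (h₁ u), by simpa using h0, fun h H hh => ?_⟩
      have hu0 : h u ≠ 0 := by
        intro h1
        have := hh u huZ
        rw [h1, sign_zero, sign_eq_zero_iff] at this
        exact h0 this
      rw [hh u huZ]
      rcases lt_or_ge 0 (h t * h u) with hp | hp
      · exact ⟨t, le_rfl, hsame t le_rfl htu, sign_eq_of_mul_pos hp⟩
      obtain ⟨c, hc, hc0⟩ := H.intermediate_value t u htu.le hp
      have hcu : c < u := lt_of_le_of_ne hc.2 fun h => hu0 (h ▸ hc0)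
      refine ⟨(c + u) / 2, by linarith [hc.1], hsame _ (by linarith [hc.1]) (by linarith), ?_⟩
      have h1 := hsub h H c hc.1 hcu
      have h2 : sign (h ((c + u) / 2) - h c) = σ c := H.sign_sub (fun d hd => by
        rw [← hσ _ _ (hsame c hc.1 hcu), ← hσ _ _ (hsame d (hc.1.trans hd.1.le)
          (by linarith [hd.2]))]) (by linarith)
      rw [hc0, sub_zero] at h1 h2
      rw [h1, h2, hσ _ _ (hsame c hc.1 hcu)]

theorem sameComponent_neg {t x : R} (h : SameComponent (Z.image (fun z => -z)) (-t) (-x)) :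
    SameComponent Z t x := fun z hz hzx => by
  refine h (-z) (Finset.mem_image_of_mem _ hz) ?_
  rw [Set.mem_uIcc] at hzx ⊢
  rcases hzx with h | h
  · exact Or.inr ⟨by linarith, by linarith⟩
  · exact Or.inl ⟨by linarith, by linarith⟩

/-- The mirror image of `exists_sign_right`. -/
theorem exists_sign_left (hσ : ∀ x y, SameComponent Z x y → σ x = σ y) {t : R} (ht : t ∉ Z)
    (hσt : σ t ≠ 0) (H₁ : PolyLike σ h₁) (H₂ : PolyLike σ h₂)
    (hZ : ∀ z ∈ Z, sign (h₁ z) = sign (h₂ z)) :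
    ∃ ρ : SignType, ρ ≠ 0 ∧
      (∃ x, x ≤ t ∧ SameComponent Z t x ∧ sign (h₁ x) = ρ) ∧
      ∃ x, x ≤ t ∧ SameComponent Z t x ∧ sign (h₂ x) = ρ := by
  obtain ⟨ρ, h0, ⟨x, hx⟩, y, hy⟩ := exists_sign_right (Z := Z.image (fun z => -z)) (t := -t)
    (σ := fun x => -σ (-x)) (h₁ := fun x => h₁ (-x)) (h₂ := fun x => h₂ (-x))
    (fun x y hxy => by
      rw [hσ (-x) (-y) (sameComponent_neg (by simpa using hxy))]) (by simpa using ht)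
    (by simpa using hσt) H₁.comp_neg H₂.comp_neg (by simpa using hZ)
  exact ⟨ρ, h0, ⟨-x, by linarith [hx.1], sameComponent_neg (by simpa using hx.2.1), hx.2.2⟩,
    -y, by linarith [hy.1], sameComponent_neg (by simpa using hy.2.1), hy.2.2⟩

omit [IsStrictOrderedRing R] in
/-- Each component contains at most one zero. -/
theorem PolyLike.eq_of_eq_zero (hσ : ∀ x y, SameComponent Z x y → σ x = σ y)
    (hσ0 : ∀ x, x ∉ Z → σ x ≠ 0) (H : PolyLike σ h) {x y : R} (hxy : SameComponent Z x y)
    (hx : h x = 0) (hy : h y = 0) : x = y := by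
  have key : ∀ {x y : R}, SameComponent Z x y → h x = 0 → h y = 0 → ¬ x < y := by
    intro x y hxy hx hy hlt
    have := H.sign_sub (fun c hc => (hσ _ _ (hxy.of_mem_uIcc
      (Set.mem_uIcc_of_le hc.1.le hc.2.le))).symm) hlt
    rw [hx, hy, sub_zero, sign_zero] at this
    exact hσ0 x hxy.left_notMem this.symm
  exact le_antisymm (not_lt.1 (key hxy.symm hy hx)) (not_lt.1 (key hxy hx hy))

/-- If `h₁` has a zero in a component, so has `h₂`: the signs of `h₁` towards the two ends of the
component are opposite, and they are those of `h₂`. -/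
theorem exists_sameComponent_eq_zero (hσ : ∀ x y, SameComponent Z x y → σ x = σ y)
    (hσ0 : ∀ x, x ∉ Z → σ x ≠ 0) (H₁ : PolyLike σ h₁) (H₂ : PolyLike σ h₂)
    (hZ : ∀ z ∈ Z, sign (h₁ z) = sign (h₂ z)) {t : R} (ht : t ∉ Z) (h0 : h₁ t = 0) :
    ∃ t', SameComponent Z t t' ∧ h₂ t' = 0 := by
  obtain ⟨ρ, hρ, ⟨x, hx, hx', hx0⟩, y, hy, hy', hy0⟩ :=
    exists_sign_right hσ ht (hσ0 t ht) H₁ H₂ hZ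
  obtain ⟨l, hl, ⟨v, hv, hv', hv0⟩, w, hw, hw', hw0⟩ :=
    exists_sign_left hσ ht (hσ0 t ht) H₁ H₂ hZ
  have h1 : ρ = σ t := by
    rw [← hx0, ← sub_zero (h₁ x), ← h0]
    refine H₁.sign_sub (fun c hc => (hσ _ _ (hx'.of_mem_uIcc
      (Set.mem_uIcc_of_le hc.1.le hc.2.le))).symm) (lt_of_le_of_ne hx ?_)
    rintro rfl
    rw [h0, sign_zero] at hx0
    exact hρ hx0.symm
  have h2 : l = -σ t := by
    rw [← hv0, hσ _ _ hv', ← H₁.sign_sub (x := v) (y := t) (fun c hc => ?_) (lt_of_le_of_ne hv ?_),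
      h0, zero_sub, Left.sign_neg, neg_neg]
    · rintro rfl
      rw [h0, sign_zero] at hv0
      exact hl hv0.symm
    · exact (hσ _ _ (hv'.symm.of_mem_uIcc (Set.mem_uIcc_of_le hc.1.le hc.2.le))).symm
  have h3 : h₂ w * h₂ y ≤ 0 := by
    by_contra! hpos
    have := sign_eq_of_mul_pos hpos
    rw [hw0, hy0, h1, h2] at this
    have h4 := hσ0 t ht
    revert this h4
    cases σ t <;> decide
  obtain ⟨c, hc, hc0⟩ := H₂.intermediate_value w y (hw.trans hy) h3
  refine ⟨c, fun z hz hzc => ?_, hc0⟩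
  rcases le_total c t with hct | hct
  · rw [Set.uIcc_of_ge hct] at hzc
    exact hw' z hz (by rw [Set.uIcc_of_ge hw]; exact ⟨hc.1.trans hzc.1, hzc.2⟩)
  · rw [Set.uIcc_of_le hct] at hzc
    exact hy' z hz (by rw [Set.uIcc_of_le hy]; exact ⟨hzc.1, hzc.2.trans hc.2⟩)

theorem PolyLike.sign_eq (H : PolyLike σ h) {x y : R} (hne : ∀ c ∈ Set.uIcc x y, h c ≠ 0) :
    sign (h x) = sign (h y) := by
  rcases le_total x y with hxy | hxy
  · rw [Set.uIcc_of_le hxy] at hne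
    refine sign_eq_of_mul_pos (not_le.1 fun hle => ?_)
    obtain ⟨c, hc, h0⟩ := H.intermediate_value x y hxy hle
    exact hne c hc h0
  · rw [Set.uIcc_of_ge hxy] at hne
    refine (sign_eq_of_mul_pos (not_le.1 fun hle => ?_)).symm
    obtain ⟨c, hc, h0⟩ := H.intermediate_value y x hxy hle
    exact hne c hc h0

/-- Two functions with the same signs on `Z` and the same sign of the derivative have the same
sign pattern: their zeros outside `Z` are matched by an order isomorphism that fixes `Z`. -/
theorem exists_orderIso_sign_eq (hσ : ∀ x y, SameComponent Z x y → σ x = σ y)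
    (hσ0 : ∀ x, x ∉ Z → σ x ≠ 0) (H₁ : PolyLike σ h₁) (H₂ : PolyLike σ h₂)
    (hZ : ∀ z ∈ Z, sign (h₁ z) = sign (h₂ z)) {T : Finset R}
    (hT : ∀ t, t ∈ T ↔ t ∉ Z ∧ h₁ t = 0) :
    ∃ θ : R ≃o R, (∀ x, x ∉ Z → SameComponent Z x (θ x)) ∧ (∀ z ∈ Z, θ z = z) ∧
      ∀ x, sign (h₁ x) = sign (h₂ (θ x)) := by
  choose! g hg hg0 using fun t (ht : t ∈ T) => exists_sameComponent_eq_zero hσ hσ0 H₁ H₂ hZ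
    ((hT t).1 ht).1 ((hT t).1 ht).2
  obtain ⟨θ, hθT, hθ⟩ := exists_orderIso_moves T g hg fun s hs t ht hst =>
    H₁.eq_of_eq_zero hσ hσ0 hst ((hT s).1 hs).2 ((hT t).1 ht).2
  have hfix : ∀ z ∈ Z, θ z = z := fun z hz => hθ z fun t _ h => h z hz Set.left_mem_uIcc
  have hsame : ∀ x, x ∉ Z → SameComponent Z x (θ x) := fun x hx z hz hzx => by
    rcases Set.mem_uIcc.1 hzx with h | h
    · have h1 := θ.monotone h.1
      rw [hfix z hz] at h1
      exact hx (θ.injective ((le_antisymm h1 h.2).trans (hfix z hz).symm) ▸ hz)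
    · have h1 := θ.monotone h.2
      rw [hfix z hz] at h1
      exact hx (θ.injective ((le_antisymm h.1 h1).trans (hfix z hz).symm) ▸ hz)
  refine ⟨θ, hsame, hfix, fun x => ?_⟩
  by_cases hx : x ∈ Z
  · rw [hfix x hx, hZ x hx]
  by_cases hroot : ∃ t ∈ T, SameComponent Z t x
  · -- the signs at `x` and `θ x` depend on their position relative to the zeros `t` and `θ t`
    obtain ⟨t, ht, htx⟩ := hroot
    have h1 := ((hT t).1 ht).2
    have h2 : h₂ (θ t) = 0 := by rw [hθT t ht]; exact hg0 t ht
    have h3 : SameComponent Z (θ t) (θ x) :=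
      ((hsame t ((hT t).1 ht).1).symm.trans htx).trans (hsame x hx)
    have hc : ∀ {x y : R}, SameComponent Z x y → ∀ c ∈ Set.Ioo x y, σ c = σ x := fun hxy c hc =>
      (hσ _ _ (hxy.of_mem_uIcc (Set.mem_uIcc_of_le hc.1.le hc.2.le))).symm
    rcases lt_trichotomy t x with hlt | rfl | hlt
    · have h4 := H₁.sign_sub (hc htx) hlt
      have h5 := H₂.sign_sub (hc h3) (θ.strictMono hlt)
      rw [h1, sub_zero] at h4
      rw [h2, sub_zero] at h5
      rw [h4, h5, hσ _ _ htx, hσ _ _ h3, hσ _ _ (hsame x hx)]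
    · rw [h1, h2]
    · have h4 := H₁.sign_sub (hc htx.symm) hlt
      have h5 := H₂.sign_sub (hc h3.symm) (θ.strictMono hlt)
      rw [h1, zero_sub, Left.sign_neg] at h4
      rw [h2, zero_sub, Left.sign_neg] at h5
      rw [← neg_inj, h4, h5, hσ _ _ (hsame x hx)]
  · -- neither function has a zero in this component, so its sign is the sign at the right end
    push Not at hroot
    have hn1 : ∀ y, SameComponent Z x y → h₁ y ≠ 0 := fun y hxy h0 =>
      hroot y ((hT y).2 ⟨hxy.symm.left_notMem, h0⟩) hxy.symm
    have hn2 : ∀ y, SameComponent Z x y → h₂ y ≠ 0 := fun y hxy h0 => by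
      obtain ⟨t, hyt, ht0⟩ := exists_sameComponent_eq_zero hσ hσ0 H₂ H₁
        (fun z hz => (hZ z hz).symm) hxy.symm.left_notMem h0
      exact hn1 t (hxy.trans hyt) ht0
    obtain ⟨ρ, -, ⟨y, -, hy, hy0⟩, w, -, hw, hw0⟩ :=
      exists_sign_right hσ hx (hσ0 x hx) H₁ H₂ hZ
    rw [H₁.sign_eq fun c hc => hn1 c (hy.of_mem_uIcc hc), hy0, ← hw0]
    have hθw := (hsame x hx).symm.trans hw
    exact (H₂.sign_eq fun c hc => hn2 c ((hsame x hx).trans (hθw.of_mem_uIcc hc))).symm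

end PiecewiseMonotone

/-! ### Elimination of one variable -/

section Elimination

open SignType

section Unbounded

variable {R : Type*} [Field R] [LinearOrder R] [IsStrictOrderedRing R]

/-- A non-constant polynomial tends to infinity in absolute value. -/
theorem exists_forall_lt_abs_eval {p : R[X]} (hp : 0 < p.degree) (K : R) :
    ∃ M, ∀ y, M < y → K < |p.eval y| := by
  revert K
  refine degree_pos_induction_on
    (P := fun p => ∀ K, ∃ M, ∀ y, M < y → K < |p.eval y|) p hp ?_ ?_ ?_
  · intro a ha K
    refine ⟨|K| / |a|, fun y hy => ?_⟩
    have hy0 : 0 < y := lt_of_le_of_lt (by positivity) hy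
    rw [div_lt_iff₀ (abs_pos.2 ha)] at hy
    rw [eval_mul, eval_C, eval_X, abs_mul, abs_of_pos hy0]
    linarith [le_abs_self K, mul_comm y |a|]
  · intro p _ ih K
    obtain ⟨M, hM⟩ := ih K
    refine ⟨max M 1, fun y hy => ?_⟩
    obtain ⟨h1, h2⟩ := max_lt_iff.1 hy
    rw [eval_mul, eval_X, abs_mul, abs_of_pos (zero_lt_one.trans h2)]
    nlinarith [hM y h1, abs_nonneg (p.eval y)]
  · intro p a _ ih K
    obtain ⟨M, hM⟩ := ih (K + |a|)
    refine ⟨M, fun y hy => ?_⟩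
    rw [eval_add, eval_C]
    have := abs_sub_abs_le_abs_sub (p.eval y) (-a)
    rw [abs_neg, sub_neg_eq_add] at this
    linarith [hM y hy]

theorem exists_lt_lt_abs_eval {p : R[X]} (hp : 0 < p.degree) (M K : R) :
    ∃ y, y < M ∧ K < |p.eval y| := by
  have hX : (-X : R[X]).natDegree = 1 := by simp
  have hp' : 0 < (p.comp (-X)).degree := by
    rw [← natDegree_pos_iff_degree_pos, natDegree_comp, hX, mul_one]
    exact natDegree_pos_iff_degree_pos.2 hp
  obtain ⟨M', h⟩ := exists_forall_lt_abs_eval hp' K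
  refine ⟨-(max M' (-M) + 1), by linarith [le_max_right M' (-M)], ?_⟩
  simpa using h (max M' (-M) + 1) (by linarith [le_max_left M' (-M)])

end Unbounded

variable {R : Type*} [Field R] [LinearOrder R] [IsStrictOrderedRing R] [IsRealClosed R]

omit [IsRealClosed R] in
theorem sign_mul_pos (a : R) {b : R} (hb : 0 < b) : sign (a * b) = sign a := by
  rw [sign_mul, sign_pos hb, mul_one]

theorem polyLike_eval_comp {p : R[X]} (hp : derivative p ≠ 0) (φ : R ≃o R) :
    PolyLike (fun x => sign ((derivative p).eval (φ x))) (fun x => p.eval (φ x)) where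
  mean_value x y hxy := by
    obtain ⟨c, hc, h⟩ := exists_derivative_mul_eq (p := p) (φ.strictMono hxy)
    refine ⟨φ.symm c, ⟨by rw [OrderIso.lt_symm_apply]; exact hc.1,
      by rw [OrderIso.symm_apply_lt]; exact hc.2⟩, ?_⟩
    rw [← h, OrderIso.apply_symm_apply, sign_mul_pos _ (sub_pos.2 (φ.strictMono hxy))]
  intermediate_value x y hxy hle := by
    obtain ⟨c, hc, h⟩ := exists_eval_eq_zero (φ.monotone hxy) hle
    exact ⟨φ.symm c, ⟨by rw [OrderIso.le_symm_apply]; exact hc.1,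
      by rw [OrderIso.symm_apply_le]; exact hc.2⟩, by rwa [OrderIso.apply_symm_apply]⟩
  unbounded_above M K := by
    obtain ⟨M', h⟩ := exists_forall_lt_abs_eval (p := p) (by
      by_contra hd
      rw [eq_C_of_degree_le_zero (not_lt.1 hd), derivative_C] at hp
      exact hp rfl) K
    refine ⟨φ.symm (max M' (φ M) + 1), ?_, ?_⟩
    · rw [OrderIso.lt_symm_apply]; linarith [le_max_right M' (φ M)]
    · rw [OrderIso.apply_symm_apply]; exact h _ (by linarith [le_max_left M' (φ M)])
  unbounded_below M K := by
    obtain ⟨y, h1, h2⟩ := exists_lt_lt_abs_eval (p := p) (by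
      by_contra hd
      rw [eq_C_of_degree_le_zero (not_lt.1 hd), derivative_C] at hp
      exact hp rfl) (φ M) K
    exact ⟨φ.symm y, by rwa [OrderIso.symm_apply_lt], by rwa [OrderIso.apply_symm_apply]⟩

/-- Suppose an order isomorphism matches the signs of two families of polynomials that contain the
derivatives of `p` and `p'`, and the signs of `p` and `p'` at the zeros of the families. Then some
order isomorphism matches the signs of the families and of `p` and `p'`. -/
theorem exists_orderIso_extend {ι : Type*} [Finite ι] {q q' : ι → R[X]} {p p' : R[X]} {φ : R ≃o R}
    (hφ : ∀ i x, sign ((q i).eval x) = sign ((q' i).eval (φ x))) {j : ι}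
    (hj : q j = derivative p) (hj' : q' j = derivative p') (hne : derivative p ≠ 0)
    (hz : ∀ i, q i ≠ 0 → ∀ x, (q i).eval x = 0 → sign (p.eval x) = sign (p'.eval (φ x))) :
    ∃ ψ : R ≃o R, (∀ i x, sign ((q i).eval x) = sign ((q' i).eval (ψ x))) ∧
      ∀ x, sign (p.eval x) = sign (p'.eval (ψ x)) := by
  classical
  have := Fintype.ofFinite ι
  let Z : Finset R := Finset.univ.biUnion fun i => (q i).roots.toFinset
  have hZ : ∀ x, x ∈ Z ↔ ∃ i, q i ≠ 0 ∧ (q i).eval x = 0 := fun x => by simp [Z]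
  have hsame : ∀ i x y, SameComponent Z x y → sign ((q i).eval x) = sign ((q i).eval y) := by
    intro i x y hxy
    by_cases hi : q i = 0
    · simp [hi]
    · exact sign_eval_eq_of_ne_zero fun z hz h0 => hxy z ((hZ z).2 ⟨i, hi, h0⟩) hz
  have hp0 : p ≠ 0 := by rintro rfl; simp at hne
  have hne' : derivative p' ≠ 0 := by
    intro h
    refine hne (Polynomial.funext fun x => ?_)
    have := hφ j x
    rwa [hj, hj', h, eval_zero, sign_zero, sign_eq_zero_iff, ← eval_zero (x := x)] at this
  obtain ⟨θ, h1, h2, h3⟩ := exists_orderIso_sign_eq (Z := Z)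
    (σ := fun x => sign ((derivative p).eval x)) (h₁ := fun x => p.eval x)
    (h₂ := fun x => p'.eval (φ x)) (T := p.roots.toFinset \ Z)
    (fun x y hxy => by rw [← hj]; exact hsame j x y hxy)
    (fun x hx h0 => hx ((hZ x).2 ⟨j, hj ▸ hne, by rwa [hj, ← sign_eq_zero_iff]⟩))
    (polyLike_eval_comp hne (OrderIso.refl R))
    (by
      have := polyLike_eval_comp hne' φ
      simp only [← hj', ← hφ] at this
      rwa [hj] at this)
    (fun z hz' => by obtain ⟨i, hi, h0⟩ := (hZ z).1 hz'; exact hz i hi z h0)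
    (fun t => by simp [hp0, and_comm])
  refine ⟨θ.trans φ, fun i x => ?_, h3⟩
  rw [OrderIso.trans_apply, ← hφ]
  by_cases hx : x ∈ Z
  · rw [h2 x hx]
  · exact hsame i _ _ (h1 x hx)

/-- Pseudo-division of `p` by `q`, where `c` is the coefficient of `q` in degree `k`. -/
theorem exists_pseudo_remainder {A : Type*} [CommRing A] (q : A[X]) {k : ℕ} (hk : 0 < k)
    (hq : q.natDegree ≤ k) (p : A[X]) :
    ∃ (N : ℕ) (s r : A[X]), C (q.coeff k) ^ N * p = s * q + r ∧ r.natDegree < k := by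
  induction hd : p.natDegree using Nat.strong_induction_on generalizing p with
  | _ d ih =>
    rcases lt_or_ge d k with hlt | hge
    · exact ⟨0, 0, p, by simp, hd ▸ hlt⟩
    -- cancel the terms of degree `d`
    set p₁ := C (q.coeff k) * p - C (p.coeff d) * X ^ (d - k) * q with hp₁
    have hp₁d : p₁.natDegree < d := by
      have hle : p₁.natDegree ≤ d := by
        refine (natDegree_sub_le _ _).trans (max_le ((natDegree_C_mul_le _ _).trans hd.le) ?_)
        refine natDegree_mul_le.trans ?_
        have := natDegree_C_mul_X_pow_le (p.coeff d) (d - k)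
        omega
      refine lt_of_le_of_ne hle fun h => ?_
      have hc : p₁.coeff d = 0 := by
        have : (X ^ (d - k) * q).coeff d = q.coeff k := by
          rw [coeff_X_pow_mul', if_pos (Nat.sub_le d k), Nat.sub_sub_self hge]
        rw [hp₁, coeff_sub, coeff_C_mul, mul_assoc, coeff_C_mul, this]
        ring
      rw [← h, coeff_natDegree, leadingCoeff_eq_zero] at hc
      rw [hc, natDegree_zero] at h
      omega
    obtain ⟨N, s, r, h1, h2⟩ := ih _ hp₁d p₁ rfl
    refine ⟨N + 1, s + C (q.coeff k) ^ N * (C (p.coeff d) * X ^ (d - k)), r, ?_, h2⟩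
    rw [hp₁] at h1
    linear_combination h1

/-- The polynomial `q` without its terms of degree more than `k`. -/
noncomputable def truncate {A : Type*} [CommRing A] (q : A[X]) (k : ℕ) : A[X] :=
  ∑ i ∈ Finset.range (k + 1), monomial i (q.coeff i)

theorem natDegree_truncate_le {A : Type*} [CommRing A] (q : A[X]) (k : ℕ) :
    (truncate q k).natDegree ≤ k :=
  natDegree_sum_le_of_forall_le _ _ fun _ hi =>
    (natDegree_monomial_le _).trans (Nat.lt_succ_iff.1 (Finset.mem_range.1 hi))

theorem coeff_truncate {A : Type*} [CommRing A] (q : A[X]) (k : ℕ) :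
    (truncate q k).coeff k = q.coeff k := by
  simp [truncate, coeff_monomial]

theorem map_truncate {A B : Type*} [CommRing A] [CommRing B] (f : A →+* B) (q : A[X]) :
    (truncate q (q.map f).natDegree).map f = q.map f := by
  conv_rhs => rw [(q.map f).as_sum_range]
  simp [truncate, Polynomial.map_sum]

/-- The signs of the elements of `Q` under a homomorphism `A → R` determine the sign pattern of the
family `P` of univariate polynomials, up to an order isomorphism of `R`. -/
def SignDetermined (R : Type*) [Field R] [LinearOrder R] {A : Type*} [CommRing A]
    (P : Finset A[X]) : Prop :=
  ∃ Q : Finset A, ∀ α β : A →+* R, (∀ c ∈ Q, sign (α c) = sign (β c)) →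
    ∃ φ : R ≃o R, ∀ p ∈ P, ∀ x, sign ((p.map α).eval x) = sign ((p.map β).eval (φ x))

omit [IsStrictOrderedRing R] [IsRealClosed R] in
theorem SignDetermined.mono {A : Type*} [CommRing A] {P P' : Finset A[X]} (h : P ⊆ P')
    (hP : SignDetermined R P') : SignDetermined R P := by
  obtain ⟨Q, hQ⟩ := hP
  refine ⟨Q, fun α β hαβ => ?_⟩
  obtain ⟨φ, hφ⟩ := hQ α β hαβ
  exact ⟨φ, fun p hp => hφ p (h hp)⟩

/-- A polynomial `p` can be added to a family that contains its derivative and its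
pseudo-remainders by all truncations of the members of the family. -/
theorem SignDetermined.insert_of_remainders {A : Type*} [CommRing A] [DecidableEq A[X]]
    {P P' : Finset A[X]} {p : A[X]}
    (hder : derivative p ∈ P) (hsub : P ⊆ P')
    (hrem : ∀ q ∈ P, ∀ k ≤ q.natDegree, 0 < k → ∃ (N : ℕ) (s r : A[X]),
      C (q.coeff k) ^ N * p = s * truncate q k + r ∧ r ∈ P')
    (hP : SignDetermined R P') : SignDetermined R (insert p P) := by
  classical
  obtain ⟨Q, hQ⟩ := hP
  let coeffs : A[X] → Finset A := fun q => (Finset.range (q.natDegree + 1)).image q.coeff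
  refine ⟨Q ∪ (insert p P).biUnion coeffs, fun α β hαβ => ?_⟩
  obtain ⟨φ, hφ⟩ := hQ α β fun c hc => hαβ c (Finset.mem_union_left _ hc)
  have hcoeff : ∀ q ∈ insert p P, ∀ k, sign (α (q.coeff k)) = sign (β (q.coeff k)) := by
    intro q hq k
    rcases le_or_gt k q.natDegree with hk | hk
    · exact hαβ _ (Finset.mem_union_right _ (Finset.mem_biUnion.2 ⟨q, hq,
        Finset.mem_image_of_mem _ (Finset.mem_range.2 (Nat.lt_succ_of_le hk))⟩))
    · rw [coeff_eq_zero_of_natDegree_lt hk, map_zero α, map_zero β]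
  by_cases hd : derivative (p.map α) = 0
  · -- both specializations of `p` are constant
    have hd' : derivative (p.map β) = 0 := by
      refine Polynomial.funext fun x => ?_
      have := hφ _ (hsub hder) (φ.symm x)
      rwa [← derivative_map, ← derivative_map, hd, eval_zero, sign_zero, OrderIso.apply_symm_apply,
        eq_comm, sign_eq_zero_iff, ← eval_zero (x := x)] at this
    refine ⟨φ, fun q hq x => ?_⟩
    rcases Finset.mem_insert.1 hq with rfl | hq
    · rw [eq_C_of_derivative_eq_zero hd, eq_C_of_derivative_eq_zero hd', eval_C, eval_C,
        coeff_map, coeff_map]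
      exact hcoeff q (Finset.mem_insert_self q P) 0
    · exact hφ q (hsub hq) x
  obtain ⟨ψ, h1, h2⟩ := exists_orderIso_extend (ι := P) (q := fun q => q.1.map α)
    (q' := fun q => q.1.map β) (p := p.map α) (p' := p.map β) (φ := φ)
    (fun q x => hφ q.1 (hsub q.2) x) (j := ⟨_, hder⟩) (derivative_map p α).symm
    (derivative_map p β).symm hd (by
      rintro ⟨q, hq⟩ hq0 x hx
      -- With `k` the common degree of the specializations of `q`, the truncation of `q` in degree
      -- `k` has the same specializations as `q`, with leading coefficients that do not vanish.
      have hdeg : (q.map α).natDegree = (q.map β).natDegree := by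
        have hsupp : (q.map α).support = (q.map β).support := by
          ext k
          rw [mem_support_iff, mem_support_iff, coeff_map, coeff_map, ← sign_ne_zero,
            hcoeff q (Finset.mem_insert_of_mem hq), sign_ne_zero]
        exact natDegree_eq_natDegree (by rw [degree, degree, hsupp])
      have hk : 0 < (q.map α).natDegree := by
        refine Nat.pos_of_ne_zero fun h => ?_
        rw [eq_C_of_natDegree_eq_zero h, eval_C] at hx
        exact hq0 (by rw [eq_C_of_natDegree_eq_zero h, hx, C_0])
      obtain ⟨N, s, r, h, hr⟩ := hrem q hq _ natDegree_map_le hk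
      have hα := congrArg (fun g => (g.map α).eval x) h
      have hβ := congrArg (fun g => (g.map β).eval (φ x)) h
      have hxβ : (q.map β).eval (φ x) = 0 := by
        have := hφ q (hsub hq) x
        rwa [hx, sign_zero, eq_comm, sign_eq_zero_iff] at this
      simp only [Polynomial.map_mul, Polynomial.map_pow, map_C, Polynomial.map_add, eval_mul,
        eval_pow, eval_C, eval_add, map_truncate, hx, mul_zero, zero_add] at hα
      rw [hdeg] at hβ
      simp only [Polynomial.map_mul, Polynomial.map_pow, map_C, Polynomial.map_add, eval_mul,
        eval_pow, eval_C, eval_add, map_truncate, hxβ, mul_zero, zero_add] at hβ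
      rw [← hdeg] at hβ
      have hs := hφ r hr x
      rw [← hα, ← hβ, sign_mul, sign_mul, sign_pow, sign_pow,
        hcoeff q (Finset.mem_insert_of_mem hq)] at hs
      have hc0 : β (q.coeff (q.map α).natDegree) ≠ 0 := by
        rw [← sign_ne_zero, ← hcoeff q (Finset.mem_insert_of_mem hq), sign_ne_zero, ← coeff_map,
          coeff_natDegree, leadingCoeff_ne_zero]
        exact hq0
      exact mul_left_cancel₀ (pow_ne_zero N (by simpa using hc0)) hs)
  refine ⟨ψ, fun q hq x => ?_⟩
  rcases Finset.mem_insert.1 hq with rfl | hq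
  · exact h2 x
  · exact h1 ⟨q, hq⟩ x

/-- Every finite family is sign determined. The degree bound `d` decreases when all the
polynomials of degree `d` have been traded for their derivatives and pseudo-remainders. -/
theorem signDetermined_of_natDegree_lt {A : Type*} [CommRing A] (d : ℕ) (P : Finset A[X])
    (hP : ∀ p ∈ P, p.natDegree < d) : SignDetermined R P := by
  classical
  induction d generalizing P with
  | zero =>
    exact ⟨∅, fun _ _ _ => ⟨OrderIso.refl R, fun p hp => absurd (hP p hp) (Nat.not_lt_zero _)⟩⟩
  | succ d ih =>
    rcases Nat.eq_zero_or_pos d with rfl | hd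
    · refine ⟨P.image (coeff · 0), fun α β h => ⟨OrderIso.refl R, fun p hp x => ?_⟩⟩
      rw [eq_C_of_natDegree_eq_zero (Nat.lt_one_iff.1 (hP p hp)), map_C, map_C, eval_C, eval_C]
      exact h _ (Finset.mem_image_of_mem (coeff · 0) hp)
    -- The induction on `D`, for all `L`, removes the polynomials of degree `d` one by one, at the
    -- cost of more polynomials of smaller degree in `L`.
    suffices hs : ∀ D L : Finset A[X], (∀ p ∈ D, p.natDegree ≤ d) →
        (∀ p ∈ L, p.natDegree < d) → SignDetermined R (D ∪ L) by
      simpa using hs P ∅ (fun p hp => Nat.lt_succ_iff.1 (hP p hp)) (by simp)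
    intro D
    induction D using Finset.induction_on with
    | empty => intro L _ hL; simpa using ih L hL
    | insert p D _ ihD =>
      intro L hD hL
      have hp := hD p (Finset.mem_insert_self p D)
      choose! N s r hr hrd using fun (q : A[X]) (k : ℕ) (hk : 0 < k) =>
        exists_pseudo_remainder (truncate q k) hk (natDegree_truncate_le q k) p
      let L₁ := insert (derivative p) L
      have hL₁ : ∀ q ∈ L₁, q.natDegree < d := fun q hq => by
        rcases Finset.mem_insert.1 hq with rfl | hq
        · exact (natDegree_derivative_le p).trans_lt (by omega)
        · exact hL q hq
      let L₂ := L₁ ∪ (D ∪ L₁).biUnion fun q =>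
        (Finset.Icc 1 q.natDegree).image fun k => r q k
      have hL₂ : ∀ q ∈ L₂, q.natDegree < d := fun q hq => by
        rcases Finset.mem_union.1 hq with hq | hq
        · exact hL₁ q hq
        obtain ⟨g, hg, hq⟩ := Finset.mem_biUnion.1 hq
        obtain ⟨k, hk, rfl⟩ := Finset.mem_image.1 hq
        obtain ⟨hk1, hk2⟩ := Finset.mem_Icc.1 hk
        have hgd : g.natDegree ≤ d := by
          rcases Finset.mem_union.1 hg with hg | hg
          · exact hD g (Finset.mem_insert_of_mem hg)
          · exact (hL₁ g hg).le
        exact (hrd g k hk1).trans_le (hk2.trans hgd)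
      refine SignDetermined.mono ?_ (SignDetermined.insert_of_remainders (p := p)
        (P := D ∪ L₁) (P' := D ∪ L₂) (by simp [L₁])
        (Finset.union_subset_union_right Finset.subset_union_left)
        (fun q hq k hk hk0 => ⟨N q k, s q k, r q k, ?_, ?_⟩)
        (ihD L₂ (fun q hq => hD q (Finset.mem_insert_of_mem hq)) hL₂))
      · intro q hq
        simp only [Finset.mem_union, Finset.mem_insert, L₁] at hq ⊢
        tauto
      · rw [← hr q k hk0, coeff_truncate]
      · exact Finset.mem_union_right _ (Finset.mem_union_right _ (Finset.mem_biUnion.2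
          ⟨q, hq, Finset.mem_image_of_mem _ (Finset.mem_Icc.2 ⟨hk0, hk⟩)⟩))

/-- The sign pattern of a finite family of univariate polynomials with parameters is determined, up
to an order isomorphism of the line, by the signs of finitely many expressions in the parameters. -/
theorem signDetermined {A : Type*} [CommRing A] (P : Finset A[X]) : SignDetermined R P :=
  signDetermined_of_natDegree_lt (P.sup natDegree + 1) P fun _ hp =>
    Nat.lt_succ_of_le (Finset.le_sup (f := natDegree) hp)

end Elimination

/-! ### Semi-algebraic sets -/

section SemialgebraicSets

open SignType

section Calculus

variable {R : Type*} [Field R] [LinearOrder R] [IsStrictOrderedRing R] {n : ℕ}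

theorem isBasicSemialgebraic_sign_eq (Q : Finset (MvPolynomial (Fin n) R)) (τ : Q → SignType) :
    IsBasicSemialgebraic {x : Fin n → R | ∀ q : Q, sign (MvPolynomial.eval x q.1) = τ q} := by
  classical
  let part : SignType → Finset (MvPolynomial (Fin n) R) := fun s =>
    (Finset.univ.filter fun q => τ q = s).image Subtype.val
  refine ⟨part 0, part 1 ∪ (part (-1)).image Neg.neg, ?_⟩
  have hpart : ∀ (s : SignType) (p : MvPolynomial (Fin n) R → Prop),
      (∀ q ∈ part s, p q) ↔ ∀ q : Q, τ q = s → p q.1 := fun s p => by simp [part]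
  ext x
  simp only [Set.mem_ofPred_eq, Finset.mem_union, or_imp, forall_and, Finset.forall_mem_image,
    hpart, map_neg, Left.neg_pos_iff]
  constructor
  · intro h
    exact ⟨fun q hq => sign_eq_zero_iff.1 ((h q).trans hq),
      fun q hq => sign_eq_one_iff.1 ((h q).trans hq),
      fun q hq => sign_eq_neg_one_iff.1 ((h q).trans hq)⟩
  · rintro ⟨h1, h2, h3⟩ q
    cases hq : τ q with
    | zero => exact sign_eq_zero_iff.2 (h1 q hq)
    | pos => exact sign_eq_one_iff.2 (h2 q hq)
    | neg => exact sign_eq_neg_one_iff.2 (h3 q hq)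

/-- A set is semi-algebraic if and only if membership is determined by the signs of finitely many
polynomials. -/
theorem isSemialgebraic_iff {A : Set (Fin n → R)} :
    IsSemialgebraic A ↔ ∃ Q : Finset (MvPolynomial (Fin n) R), ∀ x y,
      (∀ q ∈ Q, sign (MvPolynomial.eval x q) = sign (MvPolynomial.eval y q)) →
        x ∈ A → y ∈ A := by
  classical
  constructor
  · rintro ⟨𝒰, hfin, hbasic, rfl⟩
    choose! F G hFG using hbasic
    refine ⟨hfin.toFinset.biUnion fun B => F B ∪ G B, fun x y h => ?_⟩
    rintro ⟨B, hB, hx⟩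
    refine ⟨B, hB, ?_⟩
    have h' : ∀ q ∈ F B ∪ G B, sign (MvPolynomial.eval x q) = sign (MvPolynomial.eval y q) :=
      fun q hq => h q (Finset.mem_biUnion.2 ⟨B, hfin.mem_toFinset.2 hB, hq⟩)
    rw [hFG B hB] at hx ⊢
    refine ⟨fun p hp => ?_, fun q hq => ?_⟩
    · rw [← sign_eq_zero_iff, ← h' p (Finset.mem_union_left _ hp), hx.1 p hp, sign_zero]
    · rw [← sign_eq_one_iff, ← h' q (Finset.mem_union_right _ hq), sign_pos (hx.2 q hq)]
  · rintro ⟨Q, hQ⟩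
    let B : (Q → SignType) → Set (Fin n → R) := fun τ =>
      {x | ∀ q : Q, sign (MvPolynomial.eval x q.1) = τ q}
    refine ⟨{C | C ∈ Set.range B ∧ C ⊆ A}, (Set.finite_range B).subset fun C hC => hC.1, ?_, ?_⟩
    · rintro _ ⟨⟨τ, rfl⟩, -⟩
      exact isBasicSemialgebraic_sign_eq Q τ
    · refine Set.Subset.antisymm (fun x hx => ?_) (Set.sUnion_subset fun C hC => hC.2)
      exact ⟨B fun q => sign (MvPolynomial.eval x q.1), ⟨⟨_, rfl⟩, fun y hy =>
        hQ x y (fun q hq => (hy ⟨q, hq⟩).symm) hx⟩, fun q => rfl⟩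

theorem IsSemialgebraic.compl {A : Set (Fin n → R)} (hA : IsSemialgebraic A) :
    IsSemialgebraic Aᶜ := by
  rw [isSemialgebraic_iff] at hA ⊢
  obtain ⟨Q, hQ⟩ := hA
  exact ⟨Q, fun x y h hx hy => hx (hQ y x (fun q hq => (h q hq).symm) hy)⟩

theorem isSemialgebraic_setOf_forall {ι : Type*} [Finite ι] {P : ι → (Fin n → R) → Prop}
    (h : ∀ i, IsSemialgebraic {x | P i x}) : IsSemialgebraic {x | ∀ i, P i x} := by
  classical
  have := Fintype.ofFinite ι
  simp only [isSemialgebraic_iff] at h ⊢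
  choose Q hQ using h
  exact ⟨Finset.univ.biUnion Q, fun x y h hx i => hQ i x y (fun q hq =>
    h q (Finset.mem_biUnion.2 ⟨i, Finset.mem_univ i, hq⟩)) (hx i)⟩

theorem IsSemialgebraic.inter {A B : Set (Fin n → R)} (hA : IsSemialgebraic A)
    (hB : IsSemialgebraic B) : IsSemialgebraic (A ∩ B) := by
  have := isSemialgebraic_setOf_forall (P := fun (b : Bool) x => x ∈ cond b A B)
    (by rintro (_ | _) <;> assumption)
  refine (congrArg IsSemialgebraic (Set.ext fun x => ?_)).mp this
  exact ⟨fun h => ⟨h true, h false⟩, fun h b => by cases b; exacts [h.2, h.1]⟩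

theorem isSemialgebraic_setOf_imp {P : Prop} {A : Set (Fin n → R)}
    (hA : P → IsSemialgebraic A) : IsSemialgebraic {x | P → x ∈ A} := by
  by_cases h : P
  · simpa [h] using hA h
  · exact isSemialgebraic_iff.2 ⟨∅, fun x y _ _ h' => absurd h' h⟩

theorem isSemialgebraic_eval_eq_zero (p : MvPolynomial (Fin n) R) :
    IsSemialgebraic {x | MvPolynomial.eval x p = 0} :=
  isSemialgebraic_iff.2 ⟨{p}, fun x y h hx => by
    have := h p (Finset.mem_singleton_self p)
    rw [Set.mem_ofPred_eq] at hx
    rwa [hx, sign_zero, eq_comm, sign_eq_zero_iff] at this⟩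

theorem isSemialgebraic_eval_pos (p : MvPolynomial (Fin n) R) :
    IsSemialgebraic {x | 0 < MvPolynomial.eval x p} :=
  isSemialgebraic_iff.2 ⟨{p}, fun x y h hx => by
    have := h p (Finset.mem_singleton_self p)
    rwa [sign_pos hx, eq_comm, sign_eq_one_iff] at this⟩

theorem IsSemialgebraic.preimage_comp {A : Set (Fin n → R)} (hA : IsSemialgebraic A) {N : ℕ}
    (c : Fin n → Fin N) : IsSemialgebraic {v : Fin N → R | v ∘ c ∈ A} := by
  classical
  rw [isSemialgebraic_iff] at hA ⊢
  obtain ⟨Q, hQ⟩ := hA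
  refine ⟨Q.image (MvPolynomial.rename c), fun x y h => hQ _ _ fun q hq => ?_⟩
  have := h _ (Finset.mem_image_of_mem _ hq)
  rwa [MvPolynomial.eval_rename, MvPolynomial.eval_rename] at this

end Calculus

section ComplexPolynomial

variable {R : Type*} [Field R] {n : ℕ}

/-- A function `Rᴺ → C` is polynomial if its real and imaginary parts are. -/
def IsComplexPolynomial {N : ℕ} (g : (Fin N → R) → AlgebraicClosure R) : Prop :=
  ∃ U V : MvPolynomial (Fin N) R, ∀ v,
    g v = toComplex (MvPolynomial.eval v U) (MvPolynomial.eval v V)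

namespace IsComplexPolynomial

variable {N : ℕ} {g h : (Fin N → R) → AlgebraicClosure R}

theorem algebraMap (p : MvPolynomial (Fin N) R) :
    IsComplexPolynomial fun v => algebraMap R (AlgebraicClosure R) (MvPolynomial.eval v p) :=
  ⟨p, 0, fun v => by simp [toComplex]⟩

theorem add (hg : IsComplexPolynomial g) (hh : IsComplexPolynomial h) :
    IsComplexPolynomial fun v => g v + h v := by
  obtain ⟨U, V, h1⟩ := hg
  obtain ⟨U', V', h2⟩ := hh
  exact ⟨U + U', V + V', fun v => by simp only [h1, h2, toComplex_add, map_add]⟩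

theorem mul (hg : IsComplexPolynomial g) (hh : IsComplexPolynomial h) :
    IsComplexPolynomial fun v => g v * h v := by
  obtain ⟨U, V, h1⟩ := hg
  obtain ⟨U', V', h2⟩ := hh
  exact ⟨U * U' - V * V', U * V' + V * U', fun v => by
    simp only [h1, h2, toComplex_mul, map_add, map_sub, map_mul]⟩

theorem pow (hg : IsComplexPolynomial g) (k : ℕ) : IsComplexPolynomial fun v => g v ^ k := by
  induction k with
  | zero => simpa using algebraMap (1 : MvPolynomial (Fin N) R)
  | succ k ih => simpa only [pow_succ] using ih.mul hg

theorem isSemialgebraic_eq_zero [LinearOrder R] [IsStrictOrderedRing R]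
    (hg : IsComplexPolynomial g) : IsSemialgebraic {v | g v = 0} := by
  obtain ⟨U, V, h⟩ := hg
  convert (isSemialgebraic_eval_eq_zero U).inter (isSemialgebraic_eval_eq_zero V) using 1
  ext v
  simp only [Set.mem_ofPred_eq, Set.mem_inter_iff, h]
  refine ⟨toComplex_eq_zero, fun ⟨h1, h2⟩ => ?_⟩
  rw [h1, h2]; simp [toComplex]

end IsComplexPolynomial

/-- The polynomial `F(a, x)` over the algebraic closure. -/
noncomputable def specialize (F : (MvPolynomial (Fin n) R)[X]) (a : Fin n → R) :
    (AlgebraicClosure R)[X] :=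
  F.map ((algebraMap R (AlgebraicClosure R)).comp (MvPolynomial.eval a))

theorem complexFiber_eq (f : MvPolynomial (Fin (n + 1)) R) (a : Fin n → R) :
    complexFiber f a = specialize (lastVarEquiv R n f) a := by
  rw [complexFiber, fiber, specialize, Polynomial.map_map]

theorem specialize_add (F G : (MvPolynomial (Fin n) R)[X]) (a : Fin n → R) :
    specialize (F + G) a = specialize F a + specialize G a := Polynomial.map_add _

theorem eval_specialize_monomial (k : ℕ) (c : MvPolynomial (Fin n) R) (a : Fin n → R)
    (z : AlgebraicClosure R) : (specialize (monomial k c) a).eval z =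
      algebraMap R (AlgebraicClosure R) (MvPolynomial.eval a c) * z ^ k := by
  simp [specialize]

theorem iterate_derivative_specialize (F : (MvPolynomial (Fin n) R)[X]) (a : Fin n → R) (j : ℕ) :
    derivative^[j] (specialize F a) = specialize (derivative^[j] F) a :=
  iterate_derivative_map F _ j

theorem isComplexPolynomial_eval_specialize (F : (MvPolynomial (Fin n) R)[X]) {N : ℕ}
    (c : Fin n → Fin N) {g : (Fin N → R) → AlgebraicClosure R} (hg : IsComplexPolynomial g) :
    IsComplexPolynomial fun v => (specialize F (v ∘ c)).eval (g v) := by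
  induction F using Polynomial.induction_on' with
  | add F G hF hG =>
    simp only [specialize_add, eval_add]
    exact hF.add hG
  | monomial k p =>
    simp only [eval_specialize_monomial]
    refine IsComplexPolynomial.mul ?_ (hg.pow k)
    simpa only [MvPolynomial.eval_rename] using
      IsComplexPolynomial.algebraMap (R := R) (MvPolynomial.rename c p)

end ComplexPolynomial

variable {R : Type*} [Field R] [LinearOrder R] [IsStrictOrderedRing R] [IsRealClosed R] {n : ℕ}

/-- The Tarski–Seidenberg theorem for one variable. -/
theorem IsSemialgebraic.exists_snoc {A : Set (Fin (n + 1) → R)} (hA : IsSemialgebraic A) :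
    IsSemialgebraic {a : Fin n → R | ∃ b : R, Fin.snoc (α := fun _ => R) a b ∈ A} := by
  classical
  rw [isSemialgebraic_iff] at hA ⊢
  obtain ⟨P, hP⟩ := hA
  obtain ⟨Q, hQ⟩ := signDetermined (R := R) (P.image (lastVarEquiv R n))
  refine ⟨Q, fun a a' h => ?_⟩
  rintro ⟨b, hb⟩
  obtain ⟨φ, hφ⟩ := hQ (MvPolynomial.eval a) (MvPolynomial.eval a') h
  refine ⟨φ b, hP _ _ (fun p hp => ?_) hb⟩
  rw [← eval_fiber, ← eval_fiber]
  exact hφ _ (Finset.mem_image_of_mem _ hp) b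

/-- The Tarski–Seidenberg theorem: projections of semi-algebraic sets are semi-algebraic. -/
theorem IsSemialgebraic.exists_append {k : ℕ} {A : Set (Fin (n + k) → R)}
    (hA : IsSemialgebraic A) :
    IsSemialgebraic {a : Fin n → R | ∃ t : Fin k → R, Fin.append a t ∈ A} := by
  induction k with
  | zero =>
    refine (congrArg IsSemialgebraic (Set.ext fun a => ?_)).mpr hA
    constructor
    · rintro ⟨t, ht⟩
      rwa [Subsingleton.elim t Fin.elim0, Fin.append_elim0] at ht
    · intro ha
      exact ⟨Fin.elim0, by rwa [Fin.append_elim0]⟩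
  | succ k ih =>
    refine (congrArg IsSemialgebraic (Set.ext fun a => ?_)).mpr (ih (hA.exists_snoc (n := n + k)))
    constructor
    · rintro ⟨t, ht⟩
      refine ⟨Fin.init t, t (Fin.last k), ?_⟩
      rw [← Fin.append_snoc, Fin.snoc_init_self]
      exact ht
    · rintro ⟨t, b, h⟩
      refine ⟨Fin.snoc t b, ?_⟩
      rw [Fin.append_snoc]
      exact h

end SemialgebraicSets

/-! ### Continuity of complex roots -/

section Fibers

variable {R : Type*} [Field R] {n : ℕ} {f : MvPolynomial (Fin (n + 1)) R} {a : Fin n → R}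

/-- In characteristic zero the multiplicity of a root is the order of the first derivative that
does not vanish. -/
theorem rootMultiplicity_eq_iff {K : Type*} [Field K] [CharZero K] {p : K[X]} (hp : p ≠ 0) {t : K}
    {μ : ℕ} : p.rootMultiplicity t = μ ↔
      (∀ j < μ, (derivative^[j] p).eval t = 0) ∧ (derivative^[μ] p).eval t ≠ 0 := by
  have key := fun j => lt_rootMultiplicity_iff_isRoot_iterate_derivative (n := j) (t := t) hp
  constructor
  · rintro rfl
    refine ⟨fun j hj => (key j).1 hj j le_rfl, fun h0 => ?_⟩
    refine lt_irrefl _ ((key (p.rootMultiplicity t)).2 fun m hm => ?_)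
    rcases eq_or_lt_of_le hm with rfl | hm
    · exact h0
    · exact (key m).1 hm m le_rfl
  · rintro ⟨h1, h2⟩
    refine le_antisymm (not_lt.1 fun hlt => h2 ((key μ).1 hlt μ le_rfl)) (not_lt.1 fun hlt => ?_)
    exact lt_irrefl _ ((key (p.rootMultiplicity t)).2 fun m hm => h1 m (hm.trans_lt hlt))

theorem leadingCoeff_complexFiber (h : MvPolynomial.eval a (lastLC f) ≠ 0) :
    (complexFiber f a).leadingCoeff = algebraMap R _ (MvPolynomial.eval a (lastLC f)) := by
  rw [complexFiber_eq, specialize, leadingCoeff_map_of_leadingCoeff_ne_zero]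
  · rfl
  · exact (_root_.map_ne_zero (algebraMap R (AlgebraicClosure R))).2 h

theorem natDegree_complexFiber (h : MvPolynomial.eval a (lastLC f) ≠ 0) :
    (complexFiber f a).natDegree = (lastVarEquiv R n f).natDegree := by
  rw [complexFiber_eq, specialize, natDegree_map_of_leadingCoeff_ne_zero]
  exact (_root_.map_ne_zero (algebraMap R (AlgebraicClosure R))).2 h

theorem complexFiber_ne_zero (h : MvPolynomial.eval a (lastLC f) ≠ 0) : complexFiber f a ≠ 0 := by
  rw [← leadingCoeff_ne_zero, leadingCoeff_complexFiber h]
  simpa using h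

theorem finite_complexRoots (h : MvPolynomial.eval a (lastLC f) ≠ 0) :
    (complexRoots f a).Finite := by
  classical
  refine (complexFiber f a).roots.toFinset.finite_toSet.subset fun z hz => ?_
  simpa [complexFiber_ne_zero h] using (show (complexFiber f a).IsRoot z from hz)

theorem sum_rootMultiplicity (h : MvPolynomial.eval a (lastLC f) ≠ 0) :
    ∑ z ∈ (finite_complexRoots h).toFinset, (complexFiber f a).rootMultiplicity z =
      (lastVarEquiv R n f).natDegree := by
  classical
  rw [← natDegree_complexFiber h, (IsAlgClosed.splits _).natDegree_eq_card_roots,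
    ← Multiset.toFinset_sum_count_eq]
  refine Finset.sum_congr (Finset.ext fun z => ?_) fun z _ => (count_roots _).symm
  simp [complexRoots, complexFiber_ne_zero h]

end Fibers

section Conjugation

variable {R : Type*} [Field R] [LinearOrder R] [IsStrictOrderedRing R] [IsRealClosed R] {n : ℕ}
  {f : MvPolynomial (Fin (n + 1)) R} {a : Fin n → R}

theorem complexConj_mem_complexRoots {z : AlgebraicClosure R} (hz : z ∈ complexRoots f a) :
    complexConj R z ∈ complexRoots f a := by
  have h1 : (complexFiber f a).eval z = 0 := hz
  show (complexFiber f a).eval (complexConj R z) = 0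
  rw [complexFiber, eval_map_algebraMap] at h1 ⊢
  rw [aeval_algHom_apply, h1, map_zero]

theorem complexConj_eq_self_iff {z : AlgebraicClosure R} : complexConj R z = z ↔ im z = 0 := by
  constructor
  · intro h
    have := congrArg im h
    rw [im_complexConj] at this
    linarith
  · intro h
    exact complex_ext (re_complexConj z) (by rw [im_complexConj, h, neg_zero])

/-- If the value of a polynomial at `z` is small compared with its leading coefficient, then `z` is
near a root: the value is the leading coefficient times the product of the differences of `z` and
the roots. -/
theorem exists_root_of_normSq_eval_lt {p : (AlgebraicClosure R)[X]} {z : AlgebraicClosure R}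
    {ε : R} (hε : 0 < ε) (h : normSq R (p.eval z) < normSq R p.leadingCoeff * ε ^ p.natDegree) :
    ∃ w ∈ p.roots, normSq R (z - w) < ε := by
  by_contra! hne
  have hprod : ∀ s : Multiset (AlgebraicClosure R), (∀ w ∈ s, ε ≤ normSq R (z - w)) →
      ε ^ s.card ≤ (s.map fun w => normSq R (z - w)).prod := by
    intro s
    induction s using Multiset.induction_on with
    | empty => simp
    | cons w s ih =>
      intro hs
      rw [Multiset.card_cons, pow_succ', Multiset.map_cons, Multiset.prod_cons]
      exact mul_le_mul (hs w (Multiset.mem_cons_self w s))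
        (ih fun v hv => hs v (Multiset.mem_cons_of_mem hv)) (pow_nonneg hε.le _)
        (normSq_nonneg _)
  have hsplit := IsAlgClosed.splits p
  have heval : normSq R (p.eval z) =
      normSq R p.leadingCoeff * (p.roots.map fun w => normSq R (z - w)).prod := by
    conv_lhs => rw [hsplit.eq_prod_roots]
    rw [eval_mul, eval_C, map_mul, eval_multiset_prod, Multiset.map_map, map_multiset_prod,
      Multiset.map_map]
    simp
  rw [heval, hsplit.natDegree_eq_card_roots] at h
  exact h.not_ge (mul_le_mul_of_nonneg_left (hprod _ hne) (normSq_nonneg _))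

end Conjugation

section RootContinuity

open Topology Filter

variable {R : Type*} [Field R] [LinearOrder R] [IsStrictOrderedRing R] [IsRealClosed R]
  [TopologicalSpace R] [OrderTopology R] {n : ℕ}

/-- The topology of the plane on the algebraic closure of a real closed field. -/
noncomputable instance complexTopology : TopologicalSpace (AlgebraicClosure R) :=
  TopologicalSpace.induced (planeEquiv R).symm inferInstance

omit [OrderTopology R] in
theorem continuous_complex_iff {X : Type*} [TopologicalSpace X] {g : X → AlgebraicClosure R} :
    Continuous g ↔ Continuous (fun x => re (g x)) ∧ Continuous fun x => im (g x) :=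
  continuous_induced_rng.trans continuous_prodMk

omit [OrderTopology R] in
theorem continuous_re : Continuous (re : AlgebraicClosure R → R) :=
  (continuous_complex_iff.1 continuous_id).1

omit [OrderTopology R] in
theorem continuous_im : Continuous (im : AlgebraicClosure R → R) :=
  (continuous_complex_iff.1 continuous_id).2

instance : ContinuousAdd (AlgebraicClosure R) where
  continuous_add := continuous_complex_iff.2 ⟨by
    simp only [re_add]
    exact (continuous_re.comp continuous_fst).add (continuous_re.comp continuous_snd), by
    simp only [im_add]
    exact (continuous_im.comp continuous_fst).add (continuous_im.comp continuous_snd)⟩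

instance : ContinuousMul (AlgebraicClosure R) where
  continuous_mul := by
    have h1 := continuous_re (R := R).comp (continuous_fst (Y := AlgebraicClosure R))
    have h2 := continuous_re (R := R).comp (continuous_snd (X := AlgebraicClosure R))
    have h3 := continuous_im (R := R).comp (continuous_fst (Y := AlgebraicClosure R))
    have h4 := continuous_im (R := R).comp (continuous_snd (X := AlgebraicClosure R))
    refine continuous_complex_iff.2 ⟨?_, ?_⟩
    · simp only [re_mul]
      exact (h1.mul h2).sub (h3.mul h4)
    · simp only [im_mul]
      exact (h1.mul h4).add (h3.mul h2)

instance : T2Space (AlgebraicClosure R) :=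
  T2Space.of_injective_continuous (planeEquiv R).symm.injective continuous_induced_dom

theorem continuous_complexConj : Continuous (complexConj R) :=
  continuous_complex_iff.2 ⟨by simpa only [re_complexConj] using continuous_re, by
    simp only [im_complexConj]
    exact continuous_im.neg⟩

theorem continuous_eval_specialize (F : (MvPolynomial (Fin n) R)[X]) :
    Continuous fun p : (Fin n → R) × AlgebraicClosure R => (specialize F p.1).eval p.2 := by
  induction F using Polynomial.induction_on' with
  | add F G hF hG =>
    simp only [specialize_add, eval_add]
    exact hF.add hG
  | monomial k c =>
    simp only [eval_specialize_monomial]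
    refine Continuous.mul (continuous_complex_iff.2 ⟨?_, ?_⟩) (continuous_snd.pow k)
    · simp only [re_algebraMap]
      exact (MvPolynomial.continuous_eval c).comp continuous_fst
    · simp only [im_algebraMap]
      exact continuous_const

theorem continuous_normSq : Continuous (normSq R) := by
  show Continuous fun z : AlgebraicClosure R => re z ^ 2 + im z ^ 2
  exact (continuous_re.pow 2).add (continuous_im.pow 2)

theorem exists_forall_normSq_lt {z : AlgebraicClosure R} {V : Set (AlgebraicClosure R)}
    (hV : V ∈ 𝓝 z) : ∃ ε : R, 0 < ε ∧ ∀ w, normSq R (z - w) < ε → w ∈ V := by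
  rw [nhds_induced, mem_comap] at hV
  obtain ⟨U, hU, hUV⟩ := hV
  obtain ⟨ε, hε, h⟩ := ((nhds_basis_abs_sub_lt (re z)).prod_nhds
    (nhds_basis_abs_sub_lt (im z))).mem_iff.1 hU
  have hre : ∀ w, re (z - w) = re z - re w := fun w => by
    rw [eq_sub_iff_add_eq, ← re_add, sub_add_cancel]
  have him : ∀ w, im (z - w) = im z - im w := fun w => by
    rw [eq_sub_iff_add_eq, ← im_add, sub_add_cancel]
  refine ⟨min (ε.1 ^ 2) (ε.2 ^ 2), lt_min (pow_pos hε.1 2) (pow_pos hε.2 2), fun w hw => ?_⟩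
  obtain ⟨h1, h2⟩ := lt_min_iff.1 hw
  rw [normSq_apply, hre, him] at h1 h2
  refine hUV (h ⟨?_, ?_⟩)
  · show |re w - re z| < ε.1
    rw [abs_sub_comm]
    exact abs_lt_of_sq_lt_sq (by nlinarith [sq_nonneg (im z - im w)]) hε.1.le
  · show |im w - im z| < ε.2
    rw [abs_sub_comm]
    exact abs_lt_of_sq_lt_sq (by nlinarith [sq_nonneg (re z - re w)]) hε.2.le

variable {f : MvPolynomial (Fin (n + 1)) R} {S : Set (Fin n → R)}

/-- Near a root of `f(a, x)` there is a root of `f(b, x)`, for `b` near `a`. -/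
theorem eventually_exists_root (hLC : ∀ a ∈ S, MvPolynomial.eval a (lastLC f) ≠ 0)
    {a : Fin n → R} (ha : a ∈ S) {z : AlgebraicClosure R} (hz : z ∈ complexRoots f a)
    {V : Set (AlgebraicClosure R)} (hV : V ∈ 𝓝 z) :
    ∀ᶠ b in 𝓝[S] a, ∃ w ∈ V, w ∈ complexRoots f b := by
  obtain ⟨ε, hε, hεV⟩ := exists_forall_normSq_lt hV
  set d := (lastVarEquiv R n f).natDegree
  have h1 : Continuous fun b : Fin n → R => normSq R ((specialize (lastVarEquiv R n f) b).eval z) :=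
    continuous_normSq.comp
      ((continuous_eval_specialize (lastVarEquiv R n f)).comp (Continuous.prodMk_left z))
  have h2 : Continuous fun b : Fin n → R => (MvPolynomial.eval b (lastLC f)) ^ 2 * ε ^ d :=
    ((MvPolynomial.continuous_eval _).pow 2).mul continuous_const
  have hev : ∀ᶠ b in 𝓝 a, normSq R ((specialize (lastVarEquiv R n f) b).eval z) <
      (MvPolynomial.eval b (lastLC f)) ^ 2 * ε ^ d := by
    refine (isOpen_lt h1 h2).mem_nhds ?_
    have hz0 : (complexFiber f a).eval z = 0 := hz
    show normSq R ((specialize (lastVarEquiv R n f) a).eval z) < _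
    rw [← complexFiber_eq, hz0, normSq_eq_zero.2 rfl]
    exact mul_pos (sq_pos_of_ne_zero (hLC a ha)) (pow_pos hε d)
  filter_upwards [nhdsWithin_le_nhds hev, self_mem_nhdsWithin] with b hb hbS
  obtain ⟨w, hw, hwε⟩ := exists_root_of_normSq_eval_lt (p := complexFiber f b) (z := z) hε (by
    rw [natDegree_complexFiber (hLC b hbS), leadingCoeff_complexFiber (hLC b hbS),
      normSq_apply (algebraMap R _ _), re_algebraMap, im_algebraMap, complexFiber_eq]
    simpa using hb)
  exact ⟨w, hεV w hwε, isRoot_of_mem_roots hw⟩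

/-- Let the number of distinct roots of `f(b, x)` be constant on `S`. For `b ∈ S` near `a`, there is
a bijection of the roots of `f(a, x)` and of `f(b, x)` that moves the roots only slightly and
preserves multiplicities, realness, and the order of the real parts. Each root of `f(a, x)` has a
root of `f(b, x)` nearby, so there is exactly one; its multiplicity is at most that of the nearby
root of `f(a, x)`, since a derivative does not vanish there, and all multiplicities add up to the
degree. It is real if the nearby root of `f(a, x)` is, being equal to its conjugate. -/
theorem eventually_exists_bijOn (hLC : ∀ a ∈ S, MvPolynomial.eval a (lastLC f) ≠ 0)
    (hroots : ∀ a ∈ S, ∀ b ∈ S, (complexRoots f a).encard = (complexRoots f b).encard)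
    {a : Fin n → R} (ha : a ∈ S) {V : AlgebraicClosure R → Set (AlgebraicClosure R)}
    (hV : ∀ z ∈ complexRoots f a, V z ∈ 𝓝 z) :
    ∀ᶠ b in 𝓝[S] a, ∃ w : AlgebraicClosure R → AlgebraicClosure R,
      Set.BijOn w (complexRoots f a) (complexRoots f b) ∧
      ∀ z ∈ complexRoots f a, w z ∈ V z ∧
        (complexFiber f b).rootMultiplicity (w z) = (complexFiber f a).rootMultiplicity z ∧
        (im (w z) = 0 ↔ im z = 0) ∧
        ∀ z' ∈ complexRoots f a, re z < re z' → re (w z) < re (w z') := by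
  have hfin := finite_complexRoots (hLC a ha)
  obtain ⟨U, hU, hUd⟩ := hfin.t2_separation
  have hUn : ∀ z, U z ∈ 𝓝 z := fun z => (hU z).2.mem_nhds (hU z).1
  set F := lastVarEquiv R n f with hF
  -- the first non-vanishing derivative at a root of `f(a, x)` does not vanish nearby
  have hder : ∀ z ∈ complexRoots f a, ∀ᶠ p in 𝓝 a ×ˢ 𝓝 z, ((specialize
      (derivative^[(complexFiber f a).rootMultiplicity z] F) p.1).eval p.2) ≠ 0 := by
    intro z hz
    rw [← nhds_prod_eq]
    refine (continuous_eval_specialize _).continuousAt.eventually_ne ?_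
    rw [← iterate_derivative_specialize, hF, ← complexFiber_eq]
    exact ((rootMultiplicity_eq_iff (complexFiber_ne_zero (hLC a ha))).1 rfl).2
  choose! A hA M hM hAM using fun z hz => (eventually_prod_iff.1 (hder z hz))
  -- The condition on the conjugate forces the root near a real root to be its own conjugate, and
  -- the midpoints separate different real parts.
  let W : AlgebraicClosure R → Set (AlgebraicClosure R) := fun z =>
    V z ∩ U z ∩ {w | M z w} ∩ complexConj R ⁻¹' U (complexConj R z) ∩
      {w | im z ≠ 0 → im w ≠ 0} ∩ {w | ∀ z' ∈ complexRoots f a,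
        (re z < re z' → re w < (re z + re z') / 2) ∧ (re z' < re z → (re z' + re z) / 2 < re w)}
  have hW : ∀ z ∈ complexRoots f a, W z ∈ 𝓝 z := by
    intro z hz
    refine inter_mem (inter_mem (inter_mem (inter_mem (inter_mem (hV z hz) (hUn z)) (hM z hz))
      (continuous_complexConj.continuousAt.preimage_mem_nhds (hUn _))) ?_) ?_
    · by_cases h : im z = 0
      · simp [h]
      · filter_upwards [continuous_im.continuousAt.eventually_ne h] with w hw _ using hw
    · refine (eventually_all_finite hfin).2 fun z' _ => Filter.Eventually.and ?_ ?_
      · by_cases h : re z < re z'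
        · filter_upwards [continuous_re.continuousAt.eventually_lt_const
            (show re z < (re z + re z') / 2 by linarith)] with w hw _ using hw
        · simp [h]
      · by_cases h : re z' < re z
        · filter_upwards [continuous_re.continuousAt.eventually_const_lt
            (show (re z' + re z) / 2 < re z by linarith)] with w hw _ using hw
        · simp [h]
  filter_upwards [(eventually_all_finite hfin).2 fun z hz =>
      eventually_exists_root hLC ha hz (hW z hz),
    (eventually_all_finite hfin).2 fun z hz => nhdsWithin_le_nhds (hA z hz),
    self_mem_nhdsWithin] with b hb hbA hbS
  choose! w hwW hwb using hb
  have hwU : ∀ z ∈ complexRoots f a, w z ∈ U z := fun z hz => (hwW z hz).1.1.1.1.2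
  have hinj : Set.InjOn w (complexRoots f a) := fun z hz z' hz' h => by
    by_contra hne
    exact Set.disjoint_left.1 (hUd hz hz' hne) (hwU z hz) (h ▸ hwU z' hz')
  have himage : w '' complexRoots f a = complexRoots f b := by
    refine (finite_complexRoots (hLC b hbS)).eq_of_subset_of_encard_le' ?_ ?_
    · rintro _ ⟨z, hz, rfl⟩; exact hwb z hz
    · rw [hinj.encard_image, hroots a ha b hbS]
  have hbij : Set.BijOn w (complexRoots f a) (complexRoots f b) :=
    ⟨fun z hz => hwb z hz, hinj, himage.ge⟩
  have hle : ∀ z ∈ hfin.toFinset, (complexFiber f b).rootMultiplicity (w z) ≤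
      (complexFiber f a).rootMultiplicity z := by
    intro z hz
    rw [Set.Finite.mem_toFinset] at hz
    by_contra! hlt
    have := (lt_rootMultiplicity_iff_isRoot_iterate_derivative
      (complexFiber_ne_zero (hLC b hbS))).1 hlt _ le_rfl
    refine hAM z hz (hbA z hz) (hwW z hz).1.1.1.2 ?_
    rwa [complexFiber_eq f b, iterate_derivative_specialize] at this
  have hsum : ∑ z ∈ hfin.toFinset, (complexFiber f b).rootMultiplicity (w z) =
      ∑ z ∈ hfin.toFinset, (complexFiber f a).rootMultiplicity z := by
    rw [sum_rootMultiplicity (hLC a ha), ← sum_rootMultiplicity (hLC b hbS)]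
    refine Finset.sum_nbij w ?_ ?_ ?_ fun _ _ => rfl
    · intro z hz
      rw [Set.Finite.mem_toFinset] at hz ⊢
      exact hwb z hz
    · simpa using hinj
    · simpa using hbij.surjOn
  have hmult := (Finset.sum_eq_sum_iff_of_le hle).1 hsum
  refine ⟨w, hbij, fun z hz => ⟨(hwW z hz).1.1.1.1.1, hmult z (hfin.mem_toFinset.2 hz),
    ⟨fun h => ?_, fun h => ?_⟩, fun z' hz' hlt => ?_⟩⟩
  · by_contra hne
    exact (hwW z hz).1.2 hne h
  · rw [← complexConj_eq_self_iff]
    obtain ⟨v, hv, hv'⟩ := himage.ge (complexConj_mem_complexRoots (hwb z hz))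
    have h1 : complexConj R (w z) ∈ U z := by
      have := (hwW z hz).1.1.2
      rwa [Set.mem_preimage, complexConj_eq_self_iff.2 h] at this
    have h2 : v = z := by
      by_contra hne
      exact Set.disjoint_left.1 (hUd hv hz hne) (hwU v hv) (hv' ▸ h1)
    rw [← hv', h2]
  · exact (((hwW z hz).2 z' hz').1 hlt).trans (((hwW z' hz').2 z hz).2 hlt)

end RootContinuity

/-! ### Delineability -/

section Labelling

variable {R : Type*} [Field R] [LinearOrder R] [IsStrictOrderedRing R] [IsRealClosed R] {n : ℕ}

/-- A labelling `z₁, …, zₘ` of complex roots of `f(a, x)` with multiplicities `μ₁, …, μₘ`, such that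
exactly the first `k` roots are real, and these are in increasing order. -/
structure IsRootLabelling (f : MvPolynomial (Fin (n + 1)) R) (k : ℕ) {m : ℕ} (μ : Fin m → ℕ)
    (a : Fin n → R) (z : Fin m → AlgebraicClosure R) : Prop where
  injective : Function.Injective z
  mult : ∀ i, (complexFiber f a).rootMultiplicity (z i) = μ i
  im_eq_zero : ∀ i, im (z i) = 0 ↔ (i : ℕ) < k
  re_lt : ∀ i j : Fin m, i < j → (j : ℕ) < k → re (z i) < re (z j)

variable {f : MvPolynomial (Fin (n + 1)) R} {S : Set (Fin n → R)} {k m : ℕ} {μ : Fin m → ℕ}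
  {a : Fin n → R} {z : Fin m → AlgebraicClosure R}

theorem IsRootLabelling.mem_complexRoots (h : IsRootLabelling f k μ a z) (hμ : ∀ i, 0 < μ i)
    (i : Fin m) : z i ∈ complexRoots f a := by
  have := hμ i
  rw [← h.mult i] at this
  exact (rootMultiplicity_pos'.1 this).2

theorem IsRootLabelling.range_eq (h : IsRootLabelling f k μ a z) (hμ : ∀ i, 0 < μ i)
    (hm : (complexRoots f a).encard = m) : Set.range z = complexRoots f a := by
  refine Set.Finite.eq_of_subset_of_encard_le' (Set.finite_of_encard_eq_coe hm) ?_ ?_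
  · rintro _ ⟨i, rfl⟩
    exact h.mem_complexRoots hμ i
  · rw [hm, ← Set.image_univ, h.injective.encard_image, Set.encard_univ]
    simp

omit [LinearOrder R] [IsStrictOrderedRing R] [IsRealClosed R] in
theorem isRoot_fiber_iff {b : R} :
    (fiber f a).IsRoot b ↔ algebraMap R (AlgebraicClosure R) b ∈ complexRoots f a := by
  show _ ↔ (complexFiber f a).IsRoot _
  rw [complexFiber, IsRoot, IsRoot, eval_map_apply, FaithfulSMul.algebraMap_eq_zero_iff]

/-- The real roots in a labelling are determined by `f(a, x)`. -/
theorem IsRootLabelling.re_eq (h : IsRootLabelling f k μ a z) (hμ : ∀ i, 0 < μ i)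
    (hm : (complexRoots f a).encard = m) {z' : Fin m → AlgebraicClosure R}
    (h' : IsRootLabelling f k μ a z') (hkm : k ≤ m) (i : Fin k) :
    re (z (Fin.castLE hkm i)) = re (z' (Fin.castLE hkm i)) := by
  have hmono : ∀ {z : Fin m → AlgebraicClosure R}, IsRootLabelling f k μ a z →
      StrictMono fun i : Fin k => re (z (Fin.castLE hkm i)) := fun h i j hij =>
    h.re_lt _ _ hij j.2
  have hrange : ∀ {z : Fin m → AlgebraicClosure R}, IsRootLabelling f k μ a z →
      Set.range (fun i : Fin k => re (z (Fin.castLE hkm i))) = {b | (fiber f a).IsRoot b} := by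
    intro z h
    ext b
    rw [Set.mem_ofPred_eq, isRoot_fiber_iff]
    constructor
    · rintro ⟨i, rfl⟩
      dsimp only
      rw [im_eq_zero_iff.1 ((h.im_eq_zero _).2 i.2)]
      exact h.mem_complexRoots hμ _
    · intro hb
      rw [← h.range_eq hμ hm] at hb
      obtain ⟨i, hi⟩ := hb
      have hik : (i : ℕ) < k := by rw [← h.im_eq_zero, hi, im_algebraMap]
      exact ⟨⟨i, hik⟩, by dsimp only; rw [← re_algebraMap b, ← hi]; rfl⟩
  exact congrFun (((hmono h).range_inj (hmono h')).1 ((hrange h).trans (hrange h').symm)) i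

/-- Over each point the roots can be labelled: the real ones in increasing order, followed by the
others in any order. -/
theorem exists_isRootLabelling (h : MvPolynomial.eval a (lastLC f) ≠ 0) :
    ∃ (k m : ℕ) (_ : k ≤ m) (μ : Fin m → ℕ) (z : Fin m → AlgebraicClosure R), (∀ i, 0 < μ i) ∧
      (complexRoots f a).encard = m ∧ IsRootLabelling f k μ a z := by
  classical
  have hfin := finite_complexRoots h
  let A : Finset R := (hfin.toFinset.filter fun z => im z = 0).image re
  let B := hfin.toFinset.filter fun z => im z ≠ 0
  let e := A.orderEmbOfFin rfl
  let g := B.equivFin.symm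
  let z : Fin (A.card + B.card) → AlgebraicClosure R :=
    Fin.append (fun i => algebraMap R _ (e i)) fun i => (g i).1
  have hA : ∀ i, algebraMap R (AlgebraicClosure R) (e i) ∈ complexRoots f a := by
    intro i
    obtain ⟨w, hw, hwe⟩ := Finset.mem_image.1 (A.orderEmbOfFin_mem rfl i)
    obtain ⟨hw1, hw2⟩ := Finset.mem_filter.1 hw
    show algebraMap R (AlgebraicClosure R) (A.orderEmbOfFin rfl i) ∈ complexRoots f a
    rw [← hwe, im_eq_zero_iff.1 hw2]
    exact hfin.mem_toFinset.1 hw1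
  have hB : ∀ i, (g i).1 ∈ complexRoots f a ∧ im (g i).1 ≠ 0 := fun i => by
    obtain ⟨h1, h2⟩ := Finset.mem_filter.1 (g i).2
    exact ⟨hfin.mem_toFinset.1 h1, h2⟩
  have hz : ∀ i, z i ∈ complexRoots f a := by
    intro i
    refine Fin.addCases (fun i => ?_) (fun i => ?_) i
    · simpa only [z, Fin.append_left] using hA i
    · simpa only [z, Fin.append_right] using (hB i).1
  have hinj : Function.Injective z := by
    intro i j
    refine Fin.addCases (fun i => ?_) (fun i => ?_) i <;>
      refine Fin.addCases (fun j => ?_) (fun j => ?_) j <;>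
      simp only [z, Fin.append_left, Fin.append_right] <;> intro hij
    · rw [e.injective ((algebraMap R (AlgebraicClosure R)).injective hij)]
    · exact absurd (by rw [← hij, im_algebraMap]) (hB j).2
    · exact absurd (by rw [hij, im_algebraMap]) (hB i).2
    · rw [g.injective (Subtype.ext hij)]
  have hrange : Set.range z = complexRoots f a := by
    refine Set.Subset.antisymm (Set.range_subset_iff.2 hz) fun w hw => ?_
    by_cases him : im w = 0
    · have hmem : re w ∈ A :=
        Finset.mem_image_of_mem _ (Finset.mem_filter.2 ⟨hfin.mem_toFinset.2 hw, him⟩)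
      have : re w ∈ Set.range e := by rw [Finset.range_orderEmbOfFin]; exact hmem
      obtain ⟨i, hi⟩ := this
      exact ⟨Fin.castAdd _ i, by simp only [z, Fin.append_left]; rw [hi, im_eq_zero_iff.1 him]⟩
    · refine ⟨Fin.natAdd _ (g.symm ⟨w, Finset.mem_filter.2 ⟨hfin.mem_toFinset.2 hw, him⟩⟩), ?_⟩
      simp only [z, Fin.append_right, Equiv.apply_symm_apply]
  refine ⟨A.card, A.card + B.card, Nat.le_add_right _ _,
    fun i => (complexFiber f a).rootMultiplicity (z i), z,
    fun i => (rootMultiplicity_pos (complexFiber_ne_zero h)).2 (hz i), ?_, hinj, fun _ => rfl,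
    fun i => ?_, fun i j hij hj => ?_⟩
  · rw [← hrange, ← Set.image_univ, hinj.encard_image, Set.encard_univ]
    simp
  · refine Fin.addCases (fun i => ?_) (fun i => ?_) i
    · simp [z]
    · simpa [z] using (hB i).2
  · have hi : (i : ℕ) < A.card := lt_trans hij hj
    obtain ⟨i, rfl⟩ : ∃ i', i = Fin.castAdd B.card i' := ⟨⟨i, hi⟩, rfl⟩
    obtain ⟨j, rfl⟩ : ∃ j', j = Fin.castAdd B.card j' := ⟨⟨j, hj⟩, rfl⟩
    simp only [z, Fin.append_left, re_algebraMap]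
    exact e.strictMono hij

/-- Being a root labelling is a semi-algebraic condition on the coordinates, since multiplicities
are detected by derivatives. -/
theorem isSemialgebraic_isRootLabelling (hS : IsSemialgebraic S)
    (hLC : ∀ a ∈ S, MvPolynomial.eval a (lastLC f) ≠ 0) (k : ℕ) (μ : Fin m → ℕ) {N : ℕ}
    (c : Fin n → Fin N) (ex ey : Fin m → Fin N) :
    IsSemialgebraic {v : Fin N → R | v ∘ c ∈ S ∧
      IsRootLabelling f k μ (v ∘ c) fun i => toComplex (v (ex i)) (v (ey i))} := by
  have hz : ∀ i, IsComplexPolynomial fun v : Fin N → R => toComplex (v (ex i)) (v (ey i)) :=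
    fun i => ⟨MvPolynomial.X (ex i), MvPolynomial.X (ey i), fun v => by simp⟩
  have hder := fun i j => (isComplexPolynomial_eval_specialize
    (derivative^[j] (lastVarEquiv R n f)) c (hz i)).isSemialgebraic_eq_zero
  have h1 := hS.preimage_comp c
  have h2 := isSemialgebraic_setOf_forall fun i => isSemialgebraic_setOf_forall fun j =>
    isSemialgebraic_setOf_imp (P := i ≠ j) fun _ =>
      ((isSemialgebraic_eval_eq_zero (MvPolynomial.X (R := R) (ex i) - MvPolynomial.X (ex j))).inter
        (isSemialgebraic_eval_eq_zero (MvPolynomial.X (ey i) - MvPolynomial.X (ey j)))).compl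
  have h3 := isSemialgebraic_setOf_forall fun i => isSemialgebraic_setOf_forall
    fun j : Fin (μ i) => hder i j
  have h4 := isSemialgebraic_setOf_forall fun i => (hder i (μ i)).compl
  have h5 := isSemialgebraic_setOf_forall fun i => isSemialgebraic_setOf_imp
    (P := (i : Fin m).1 < k) fun _ => isSemialgebraic_eval_eq_zero (MvPolynomial.X (R := R) (ey i))
  have h6 := isSemialgebraic_setOf_forall fun i => isSemialgebraic_setOf_imp
    (P := ¬ (i : Fin m).1 < k) fun _ =>
      (isSemialgebraic_eval_eq_zero (MvPolynomial.X (R := R) (ey i))).compl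
  have h7 := isSemialgebraic_setOf_forall fun i => isSemialgebraic_setOf_forall fun j =>
    isSemialgebraic_setOf_imp (P := i < j ∧ (j : Fin m).1 < k) fun _ =>
      isSemialgebraic_eval_pos (MvPolynomial.X (R := R) (ex j) - MvPolynomial.X (ex i))
  refine (congrArg IsSemialgebraic (Set.ext fun v => ?_)).mp
    (h1.inter (h2.inter ((h3.inter h4).inter ((h5.inter h6).inter h7))))
  simp only [Set.mem_inter_iff, Set.mem_ofPred_eq, Set.mem_compl_iff, map_sub,
    MvPolynomial.eval_X, sub_eq_zero, sub_pos]
  refine and_congr_right fun hv => ?_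
  have hmult : ∀ i, (complexFiber f (v ∘ c)).rootMultiplicity (toComplex (v (ex i)) (v (ey i))) =
      μ i ↔ (∀ j : Fin (μ i), (specialize (derivative^[j] (lastVarEquiv R n f)) (v ∘ c)).eval
        (toComplex (v (ex i)) (v (ey i))) = 0) ∧
        (specialize (derivative^[μ i] (lastVarEquiv R n f)) (v ∘ c)).eval
          (toComplex (v (ex i)) (v (ey i))) ≠ 0 := fun i => by
    rw [rootMultiplicity_eq_iff (complexFiber_ne_zero (hLC _ hv)), complexFiber_eq]
    simp only [iterate_derivative_specialize, Fin.forall_iff]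
  constructor
  · rintro ⟨g2, ⟨g3, g4⟩, ⟨g5, g6⟩, g7⟩
    refine ⟨fun i j hij => ?_, fun i => (hmult i).2 ⟨g3 i, g4 i⟩, fun i => ?_,
      fun i j hij hj => ?_⟩
    · by_contra hne
      exact g2 i j hne (toComplex_injective hij)
    · rw [im_toComplex]
      exact ⟨fun h => by_contra fun hk => g6 i hk h, g5 i⟩
    · rw [re_toComplex, re_toComplex]
      exact g7 i j ⟨hij, hj⟩
  · intro h
    refine ⟨fun i j hij hxy => hij (h.injective ?_), ⟨fun i => ((hmult i).1 (h.mult i)).1,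
      fun i => ((hmult i).1 (h.mult i)).2⟩, ⟨fun i hi => ?_, fun i hi h0 => hi ?_⟩,
      fun i j hij => ?_⟩
    · rw [hxy.1, hxy.2]
    · simpa using (h.im_eq_zero i).2 hi
    · exact (h.im_eq_zero i).1 (by simpa using h0)
    · simpa using h.re_lt i j hij.1 hij.2

/-- The points over which the roots have a labelling of a given type form a semi-algebraic set: the
real and imaginary parts of the roots are `2 m` further coordinates that are projected away. -/
theorem isSemialgebraic_exists_isRootLabelling (hS : IsSemialgebraic S)
    (hLC : ∀ a ∈ S, MvPolynomial.eval a (lastLC f) ≠ 0) (k : ℕ) (μ : Fin m → ℕ) :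
    IsSemialgebraic {a | a ∈ S ∧ ∃ z, IsRootLabelling f k μ a z} := by
  refine (congrArg IsSemialgebraic (Set.ext fun a => ?_)).mp
    (isSemialgebraic_isRootLabelling hS hLC k μ (N := n + (m + m)) (Fin.castAdd _)
      (fun i => Fin.natAdd n (Fin.castAdd m i))
      (fun i => Fin.natAdd n (Fin.natAdd m i))).exists_append
  have hc : ∀ t : Fin (m + m) → R, Fin.append a t ∘ Fin.castAdd (m + m) = a := fun t =>
    funext fun i => Fin.append_left a t i
  simp only [Set.mem_ofPred_eq, hc, Fin.append_right]
  constructor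
  · rintro ⟨t, ha, h⟩
    exact ⟨ha, _, h⟩
  · rintro ⟨ha, z, h⟩
    exact ⟨Fin.append (fun i => re (z i)) (fun i => im (z i)), ha, by
      simpa only [Fin.append_left, Fin.append_right, toComplex_re_im] using h⟩

theorem isSemialgebraic_graph (hS : IsSemialgebraic S)
    (hLC : ∀ a ∈ S, MvPolynomial.eval a (lastLC f) ≠ 0) (k : ℕ) (μ : Fin m → ℕ) (i : Fin m) :
    IsSemialgebraic {v : Fin (n + 1) → R | ∃ a ∈ S, ∃ z, IsRootLabelling f k μ a z ∧
      v = Fin.snoc (α := fun _ => R) a (re (z i))} := by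
  have h1 := isSemialgebraic_isRootLabelling hS hLC k μ (N := n + 1 + (m + m))
    (fun i => Fin.castAdd _ i.castSucc) (fun i => Fin.natAdd (n + 1) (Fin.castAdd m i))
    (fun i => Fin.natAdd (n + 1) (Fin.natAdd m i))
  have h2 := isSemialgebraic_eval_eq_zero (MvPolynomial.X (R := R)
    (Fin.castAdd (m + m) (Fin.last n)) -
      MvPolynomial.X (Fin.natAdd (n + 1) (Fin.castAdd m i)))
  refine (congrArg IsSemialgebraic (Set.ext fun v => ?_)).mp (h1.inter h2).exists_append
  have hc : ∀ t : Fin (m + m) → R,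
      Fin.append v t ∘ (fun i : Fin n => Fin.castAdd (m + m) i.castSucc) = Fin.init v := fun t =>
    funext fun i => Fin.append_left v t i.castSucc
  simp only [Set.mem_ofPred_eq, Set.mem_inter_iff, hc, Fin.append_right, Fin.append_left, map_sub,
    MvPolynomial.eval_X, sub_eq_zero]
  constructor
  · rintro ⟨t, ⟨ha, h⟩, hv⟩
    exact ⟨_, ha, _, h, by rw [re_toComplex, ← hv, Fin.snoc_init_self]⟩
  · rintro ⟨a, ha, z, h, rfl⟩
    refine ⟨Fin.append (fun i => re (z i)) (fun i => im (z i)), ⟨?_, ?_⟩, ?_⟩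
    · simpa using ha
    · simpa only [Fin.append_left, Fin.append_right, toComplex_re_im, Fin.init_snoc] using h
    · simp

end Labelling

section Delineation

open Topology Filter

variable {R : Type*} [Field R] [LinearOrder R] [IsStrictOrderedRing R] [IsRealClosed R]
  [TopologicalSpace R] [OrderTopology R] {n : ℕ} {f : MvPolynomial (Fin (n + 1)) R}
  {S : Set (Fin n → R)} {k m : ℕ} {μ : Fin m → ℕ} {a : Fin n → R}

/-- Root labellings extend continuously to nearby points. -/
theorem IsRootLabelling.eventually_exists (hLC : ∀ a ∈ S, MvPolynomial.eval a (lastLC f) ≠ 0)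
    (hroots : ∀ a ∈ S, ∀ b ∈ S, (complexRoots f a).encard = (complexRoots f b).encard)
    (hμ : ∀ i, 0 < μ i) (ha : a ∈ S) {z : Fin m → AlgebraicClosure R}
    (h : IsRootLabelling f k μ a z)
    {V : AlgebraicClosure R → Set (AlgebraicClosure R)} (hV : ∀ w, V w ∈ 𝓝 w) :
    ∀ᶠ b in 𝓝[S] a, ∃ z', IsRootLabelling f k μ b z' ∧ ∀ i, z' i ∈ V (z i) := by
  filter_upwards [eventually_exists_bijOn hLC hroots ha fun w _ => hV w] with b hb
  obtain ⟨w, hw, hb⟩ := hb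
  have hz := h.mem_complexRoots hμ
  refine ⟨fun i => w (z i), ⟨fun i j hij => h.injective (hw.injOn (hz i) (hz j) hij),
    fun i => ?_, fun i => ?_, fun i j hij hj => ?_⟩, fun i => (hb _ (hz i)).1⟩
  · rw [(hb _ (hz i)).2.1, h.mult i]
  · rw [(hb _ (hz i)).2.2.1, h.im_eq_zero]
  · exact (hb _ (hz i)).2.2.2 _ (hz j) (h.re_lt i j hij hj)

/-- Root labellings of a given type at points near `a` come from `a`. -/
theorem eventually_isRootLabelling_imp (hLC : ∀ a ∈ S, MvPolynomial.eval a (lastLC f) ≠ 0)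
    (hroots : ∀ a ∈ S, ∀ b ∈ S, (complexRoots f a).encard = (complexRoots f b).encard)
    (hμ : ∀ i, 0 < μ i) (ha : a ∈ S) :
    ∀ᶠ b in 𝓝[S] a, (∃ z, IsRootLabelling f k μ b z) → ∃ z, IsRootLabelling f k μ a z := by
  filter_upwards [eventually_exists_bijOn hLC hroots ha (V := fun _ => Set.univ)
    fun w _ => univ_mem] with b hb
  rintro ⟨z', h⟩
  obtain ⟨w, hw, hb⟩ := hb
  choose z hz hzw using fun i => hw.surjOn (h.mem_complexRoots hμ i)
  refine ⟨z, fun i j hij => h.injective (by rw [← hzw, ← hzw, hij]), fun i => ?_, fun i => ?_,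
    fun i j hij hj => ?_⟩
  · rw [← (hb _ (hz i)).2.1, hzw, h.mult i]
  · rw [← (hb _ (hz i)).2.2.1, hzw, h.im_eq_zero]
  · rcases lt_trichotomy (re (z i)) (re (z j)) with hlt | heq | hgt
    · exact hlt
    · have him : ∀ l : Fin m, (l : ℕ) < k → im (z l) = 0 := fun l hl => by
        rw [← (hb _ (hz l)).2.2.1, hzw, h.im_eq_zero]
        exact hl
      have hzz : z i = z j :=
        complex_ext heq ((him i (lt_trans hij hj)).trans (him j hj).symm)
      refine absurd (h.injective (a₁ := i) (a₂ := j) ?_) hij.ne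
      rw [← hzw, ← hzw, hzz]
    · have := (hb _ (hz j)).2.2.2 _ (hz i) hgt
      rw [hzw, hzw] at this
      exact absurd this (h.re_lt i j hij hj).not_gt

/-- The type of a root labelling is constant on a semi-algebraically connected set: the sets of
points with and without a labelling of the given type are semi-algebraic and open. -/
theorem forall_exists_isRootLabelling (hS : IsSemialgebraic S)
    (hSc : IsSemialgebraicallyConnected S) (hLC : ∀ a ∈ S, MvPolynomial.eval a (lastLC f) ≠ 0)
    (hroots : ∀ a ∈ S, ∀ b ∈ S, (complexRoots f a).encard = (complexRoots f b).encard)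
    (hμ : ∀ i, 0 < μ i) (ha : a ∈ S) {z : Fin m → AlgebraicClosure R}
    (h : IsRootLabelling f k μ a z) :
    ∀ b ∈ S, ∃ z, IsRootLabelling f k μ b z := by
  set T := {a | a ∈ S ∧ ∃ z : Fin m → AlgebraicClosure R, IsRootLabelling f k μ a z} with hT
  have hTs : IsSemialgebraic T := isSemialgebraic_exists_isRootLabelling hS hLC k μ
  by_contra! hcon
  obtain ⟨b, hb, hbz⟩ := hcon
  refine hSc ⟨T, S ∩ Tᶜ, hTs, hS.inter hTs.compl, ⟨a, ha, z, h⟩,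
    ⟨b, hb, fun hbT => hbT.2.elim hbz⟩, ?_, ?_, ?_, ?_⟩
  · rw [← isOpen_compl_iff, isOpen_iff_mem_nhds]
    rintro ⟨x, hx⟩ hxT
    rw [← Set.preimage_compl, preimage_coe_mem_nhds_subtype]
    filter_upwards [eventually_isRootLabelling_imp (k := k) hLC hroots hμ hx] with y hy hyT
    exact hxT ⟨hx, hy hyT.2⟩
  · rw [← isOpen_compl_iff, isOpen_iff_mem_nhds]
    rintro ⟨x, hx⟩ hxT
    have hxT' : x ∈ T := by
      by_contra hne
      exact hxT ⟨hx, hne⟩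
    obtain ⟨-, w, hw⟩ := hxT'
    rw [← Set.preimage_compl, preimage_coe_mem_nhds_subtype]
    filter_upwards [hw.eventually_exists hLC hroots hμ hx (V := fun _ => Set.univ)
      fun _ => univ_mem, self_mem_nhdsWithin] with y hy hyS hyT
    obtain ⟨w', hw', -⟩ := hy
    exact hyT.2 ⟨hyS, w', hw'⟩
  · exact Set.disjoint_left.2 fun x hx hx' => hx'.2 hx
  · ext x
    by_cases hx : x ∈ T
    · simp [hx, hx.1]
    · simp [hx]

/-- If the roots have labellings of the same type over all points, the real roots in these
labellings delineate `f`. They do not depend on the choice of the labellings, which gives continuity. -/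
theorem delineable_of_isRootLabelling (hS : IsSemialgebraic S)
    (hLC : ∀ a ∈ S, MvPolynomial.eval a (lastLC f) ≠ 0)
    (hroots : ∀ a ∈ S, ∀ b ∈ S, (complexRoots f a).encard = (complexRoots f b).encard)
    (hkm : k ≤ m) (hμ : ∀ i, 0 < μ i) (hm : ∀ a ∈ S, (complexRoots f a).encard = m)
    (h : ∀ a ∈ S, ∃ z : Fin m → AlgebraicClosure R, IsRootLabelling f k μ a z) :
    Delineable f S := by
  choose! z hz using h
  have hreal : ∀ (i : Fin k) (a : S), algebraMap R (AlgebraicClosure R)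
      (re (z a (Fin.castLE hkm i))) = z a (Fin.castLE hkm i) := fun i a =>
    im_eq_zero_iff.1 (((hz a a.2).im_eq_zero _).2 i.2)
  refine ⟨k, fun i a => re (z a (Fin.castLE hkm i)), m, hkm, μ, hμ, fun a ha => ⟨z a,
    (hz a ha).injective, (hz a ha).range_eq hμ (hm a ha), (hz a ha).mult⟩, fun i => ⟨?_, ?_⟩,
    fun i j hij a => (hz a a.2).re_lt _ _ hij j.2, fun i a => ⟨?_, ?_⟩,
    fun a b hb => ?_⟩
  · refine (congrArg IsSemialgebraic (Set.ext fun v => ?_)).mp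
      (isSemialgebraic_graph hS hLC k μ (Fin.castLE hkm i))
    constructor
    · rintro ⟨a, ha, z', hz', rfl⟩
      exact ⟨⟨a, ha⟩, by rw [hz'.re_eq hμ (hm a ha) (hz a ha) hkm i]⟩
    · rintro ⟨a, rfl⟩
      exact ⟨a, a.2, z a, hz a a.2, rfl⟩
  · refine continuous_iff_continuousAt.2 fun a U hU => ?_
    rw [mem_map]
    have hev := (hz a a.2).eventually_exists hLC hroots hμ a.2
      (V := fun w => {w' | w = z a (Fin.castLE hkm i) → re w' ∈ U}) fun w => by
        by_cases hw : w = z a (Fin.castLE hkm i)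
        · subst hw
          filter_upwards [continuous_re.continuousAt.preimage_mem_nhds hU] with w' hw' _ using hw'
        · simp [hw]
    rw [nhds_subtype_eq_comap_nhdsWithin]
    refine mem_comap.2 ⟨_, hev.and self_mem_nhdsWithin, ?_⟩
    rintro b ⟨⟨z', hz', hz'V⟩, hbS⟩
    show re (z b (Fin.castLE hkm i)) ∈ U
    rw [(hz b b.2).re_eq hμ (hm b b.2) hz' hkm i]
    exact hz'V (Fin.castLE hkm i) rfl
  · rw [isRoot_fiber_iff, hreal]
    exact (hz a a.2).mem_complexRoots hμ _
  · rw [← (hz a a.2).mult, ← hreal, complexFiber]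
    exact eq_rootMultiplicity_map (algebraMap R (AlgebraicClosure R)).injective _
  · rw [isRoot_fiber_iff, ← (hz a a.2).range_eq hμ (hm a a.2)] at hb
    obtain ⟨i, hi⟩ := hb
    have hik : (i : ℕ) < k := by rw [← (hz a a.2).im_eq_zero, hi, im_algebraMap]
    exact ⟨⟨i, hik⟩, by rw [← re_algebraMap b, ← hi]; rfl⟩

end Delineation

end RealAlg

theorem mainTheorem8 {R : Type*} [Field R] [LinearOrder R] [IsStrictOrderedRing R]
    [IsRealClosed R] [TopologicalSpace R] [OrderTopology R] (n : ℕ) (hn : 1 ≤ n)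
    (f : MvPolynomial (Fin (n + 1)) R) (S : Set (Fin n → R))
    (hS : RealAlg.IsSemialgebraic S) (hSc : RealAlg.IsSemialgebraicallyConnected S)
    (hLC : ∀ a ∈ S, MvPolynomial.eval a (RealAlg.lastLC f) ≠ 0)
    (hroots : ∀ a ∈ S, ∀ b ∈ S,
      (RealAlg.complexRoots f a).encard = (RealAlg.complexRoots f b).encard) :
    RealAlg.Delineable f S := by
  rcases S.eq_empty_or_nonempty with rfl | ⟨a, ha⟩
  · exact ⟨0, Fin.elim0, 0, le_rfl, Fin.elim0, fun i => i.elim0, fun a ha => ha.elim,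
      fun i => i.elim0, fun i => i.elim0, fun i => i.elim0, fun a => a.2.elim⟩
  obtain ⟨k, m, hkm, μ, z, hμ, hm, hz⟩ := RealAlg.exists_isRootLabelling (hLC a ha)
  exact RealAlg.delineable_of_isRootLabelling hS hLC hroots hkm hμ
    (fun b hb => (hroots b hb a ha).trans hm)
    (RealAlg.forall_exists_isRootLabelling hS hSc hLC hroots hμ ha hz)
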